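/- Let $k$ be an algebraically closed field, $n\ge d\ge 1$ and $D\ge 2$ integers, and let $\mathcal A=\{\mathbf a_0,\dots,\mathbf a_n\}\subset\mathbb N^d$ be a set of $n+1$ distinct vectors $\mathbf a_i=(a_{i1},\dots,a_{id})$ such that $\mathbf a_0=\mathbf 0$, $D\epsilon'_1,\dots,D\epsilon'_d\in\mathcal A$ (with $\epsilon'_1,\dots,\epsilon'_d$ the canonical basis of $\mathbb N^d$), and $|\mathbf a_i|:=a_{i1}+\dots+a_{id}\le D$ for all $i$. Put $a_{i0}:=D-|\mathbf a_i|$, let $\underline{\mathcal A}=\{\underline{\mathbf a}_0,\dots,\underline{\mathbf a}_n\}\subset\mathbb N^{d+1}$ with $\underline{\mathbf a}_i=(a_{i0},a_{i1},\dots,a_{id})$ be the homogenization of $\mathcal A$, let $\epsilon_0,\dots,\epsilon_d$ be the canonical basis of $\mathbb N^{d+1}$, and let $\mathcal X_{\underline{\mathcal A}}=V(I_{\underline{\mathcal A}})\subset\mathbb P^n_k$, where $I_{\underline{\mathcal A}}$ is the kernel of the $k$-algebra homomorphism $k[x_0,\dots,x_n]\to k[t_0,\dots,t_d]$, $x_i\mapsto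 t_0^{a_{i0}}t_1^{a_{i1}}\cdots t_d^{a_{id}}$. For $s\in\mathbb N$ let $s\mathcal A$ be the set of all sums of $s$ elements of $\mathcal A$ (repetitions allowed, $0\mathcal A=\{\mathbf 0\}$), and for $e\ge 1$ put $\mathbb N^d_e=\{\mathbf y\in\mathbb N^d: e \text{ divides } |\mathbf y|\}$ and $\Delta_{s,e}=\{\mathbf y\in\mathbb N^d_e: |\mathbf y|\le sD\}$. Consider the following conditions, the last three for a positive integer $e$: (a) $\mathcal X_{\underline{\mathcal A}}$ has exactly one singular point, and it is $(1:0:\dots:0)$. (b$_e$) $e\le D$ is a divisor of $D$ that divides $a_{i0}$ for all $i\in\{0,\dots,n\}$; $\{(D-1)\epsilon_i+\epsilon_j: 1\le i,j\le d\}\cup\{e\epsilon_0+(D-e)\epsilon_j: 1\le j\le d\}\subset\underline{\mathcal A}$; and if $e=1$, then $(D-1)\epsilon_0+\epsilon_j\notin\underline{\mathcal A}$ for some $j\in\{1,\dots,d\}$. (c$_e$) $e\le D$ is a divisor of $D$ that divides $|\mathbf a_i|$ for all $i\in\{0,\dots,n\}$; $\{\mathbf 0\}\cup\{(D-1)\epsilon'_i+\epsilon'_j: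 1\le i,j\le d\}\cup\{(D-e)\epsilon'_i: 1\le i\le d\}\subset\mathcal A$; and if $e=1$, then $\epsilon'_j\notin\mathcal A$ for some $j\in\{1,\dots,d\}$. (d$_e$) There exist a finite set $\mathcal H\subset\mathbb N^d_e$, with $\mathcal H\ne\emptyset$ if $e=1$, and a number $s_0\in\mathbb N$ such that $s\mathcal A=\Delta_{s,e}\setminus\mathcal H$ for all $s\ge s_0$. Then, for every $e$, the conditions (b$_e$), (c$_e$) and (d$_e$) are equivalent. If moreover the greatest common divisor of all the coordinates $a_{ij}$ ($0\le i\le n$, $1\le j\le d$) is $1$, then the following are equivalent: (a); (b$_e$) holds for some $e$; (c$_e$) holds for some $e$; (d$_e$) holds for some $e$. -/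

import Mathlib

open MvPolynomial

noncomputable section

namespace OneSing

/-! ### Projective algebraic sets and their singular points -/

/-- The projective zero locus `V(I) ⊆ ℙⁿ(k)`: a point of `ℙⁿ(k)` is a line in `k^(n+1)`, and it
belongs to `V(I)` when every element of `I` vanishes on that line (for a homogeneous ideal it
suffices to test one nonzero vector of the line). -/
def projZeroLocus {k : Type*} [Field k] {n : ℕ} (I : Ideal (MvPolynomial (Fin (n + 1)) k)) :
    Set (Projectivization k (Fin (n + 1) → k)) :=
  {P | (P.submodule : Set (Fin (n + 1) → k)) ⊆ zeroLocus k I}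

/-- The affine cone over a subset of projective space: the union of the lines in it. -/
def affineCone {k : Type*} [Field k] {n : ℕ} (X : Set (Projectivization k (Fin (n + 1) → k))) :
    Set (Fin (n + 1) → k) :=
  {v | ∃ P ∈ X, v ∈ P.submodule}

/-- The vanishing ideal `I(X)` of `X ⊆ ℙⁿ(k)`. -/
def projVanishingIdeal {k : Type*} [Field k] {n : ℕ}
    (X : Set (Projectivization k (Fin (n + 1) → k))) : Ideal (MvPolynomial (Fin (n + 1)) k) :=
  vanishingIdeal k (affineCone X)

/-- The row space of the Jacobian matrix of the ideal `I` at the vector `v`: the span of the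
gradients at `v` of the elements of `I`. -/
def jacobianSpan {k : Type*} [Field k] {n : ℕ} (I : Ideal (MvPolynomial (Fin (n + 1)) k))
    (v : Fin (n + 1) → k) : Submodule k (Fin (n + 1) → k) :=
  Submodule.span k {w | ∃ f ∈ I, w = fun i => eval v (pderiv i f)}

/-- `P` is a singular point of the projective variety `X ⊆ ℙⁿ(k)`: it lies on `X` and the rank at
`P` of the Jacobian matrix of `I(X)` is smaller than the codimension `n - dim X`. Here `dim X + 1` is
the Krull dimension of the homogeneous coordinate ring, and `rank < n - dim X` is written as
`rank + (dim X + 1) < n + 1`. -/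
def IsSingularPoint {k : Type*} [Field k] {n : ℕ} (X : Set (Projectivization k (Fin (n + 1) → k)))
    (P : Projectivization k (Fin (n + 1) → k)) : Prop :=
  P ∈ X ∧
    ((Module.finrank k (jacobianSpan (projVanishingIdeal X) P.rep) : ℕ) : WithBot ℕ∞) +
      ringKrullDim (MvPolynomial (Fin (n + 1)) k ⧸ projVanishingIdeal X) <
        ((n + 1 : ℕ) : WithBot ℕ∞)

/-- The point `(1 : 0 : ⋯ : 0)` of `ℙⁿ(k)`. -/
def firstPoint (k : Type*) [Field k] (n : ℕ) : Projectivization k (Fin (n + 1) → k) :=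
  Projectivization.mk k (Pi.single 0 1) (by simp)

/-! ### Toric ideals and projective toric varieties -/

/-- The toric ideal of `b₀, …, bₙ ∈ ℕ^m`: the kernel of `k[x₀, …, xₙ] → k[t₁, …, t_m]`,
`xᵢ ↦ t^(bᵢ)`. -/
def toricIdeal (k : Type*) [Field k] {n m : ℕ} (b : Fin (n + 1) → Fin m → ℕ) :
    Ideal (MvPolynomial (Fin (n + 1)) k) :=
  RingHom.ker
    (aeval (fun i => ∏ j, X j ^ b i j) : MvPolynomial (Fin (n + 1)) k →ₐ[k] MvPolynomial (Fin m) k)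

/-- The projective toric variety `V(I_b) ⊆ ℙⁿ(k)`. -/
def toricVariety (k : Type*) [Field k] {n m : ℕ} (b : Fin (n + 1) → Fin m → ℕ) :
    Set (Projectivization k (Fin (n + 1) → k)) :=
  projZeroLocus (toricIdeal k b)

/-! ### Point sets in `ℕ^d` -/

/-- The coordinate sum `|y|`. -/
def size {d : ℕ} (y : Fin d → ℕ) : ℕ := ∑ j, y j

/-- The homogenization `(D - |aᵢ|, aᵢ₁, …, aᵢ_d)` of the vectors `aᵢ` (used when `|aᵢ| ≤ D`). -/
def homogenization {d n : ℕ} (D : ℕ) (a : Fin (n + 1) → Fin d → ℕ) :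
    Fin (n + 1) → Fin (d + 1) → ℕ :=
  fun i => Fin.cons (D - size (a i)) (a i)

/-- The `s`-fold sumset `sA`; in particular `0A = {0}`. -/
def sumset {d : ℕ} (s : ℕ) (A : Set (Fin d → ℕ)) : Set (Fin d → ℕ) :=
  {y | ∃ f : Fin s → Fin d → ℕ, (∀ t, f t ∈ A) ∧ y = ∑ t, f t}

/-- `ℕ_e^d`, the vectors whose coordinate sum is divisible by `e`. -/
def latticeMod (d e : ℕ) : Set (Fin d → ℕ) := {y | e ∣ size y}

/-- `Δ_{s,e}`, the vectors in `ℕ_e^d` with coordinate sum at most `s D`. -/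
def simplexMod (d D s e : ℕ) : Set (Fin d → ℕ) := {y | y ∈ latticeMod d e ∧ size y ≤ s * D}

/-! ### The four conditions -/

/-- The toric variety of the homogenization has exactly one singular point, `(1 : 0 : ⋯ : 0)`. -/
def SingleSingularPoint (k : Type*) [Field k] {d n : ℕ} (D : ℕ) (a : Fin (n + 1) → Fin d → ℕ) :
    Prop :=
  {P | IsSingularPoint (toricVariety k (homogenization D a)) P} = {firstPoint k n}

/-- The shape of the homogenization, for a given `e`. Coordinate `0` of `ℕ^(d+1)` is the
homogenizing one. -/
def HomogenizedShape {d n : ℕ} (D : ℕ) (a : Fin (n + 1) → Fin d → ℕ) (e : ℕ) : Prop :=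
  1 ≤ e ∧ e ≤ D ∧ e ∣ D ∧
    (∀ i j : Fin d, (Pi.single i.succ (D - 1) + Pi.single j.succ 1 : Fin (d + 1) → ℕ) ∈
      Set.range (homogenization D a)) ∧
    (∀ j : Fin d, (Pi.single 0 e + Pi.single j.succ (D - e) : Fin (d + 1) → ℕ) ∈
      Set.range (homogenization D a)) ∧
    (∀ i, e ∣ homogenization D a i 0) ∧
    (e = 1 → ∃ j : Fin d, (Pi.single 0 (D - 1) + Pi.single j.succ 1 : Fin (d + 1) → ℕ) ∉
      Set.range (homogenization D a))

/-- The shape of the set `A = {a₀, …, aₙ}` itself, for a given `e`. -/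
def AffineShape {d n : ℕ} (D : ℕ) (a : Fin (n + 1) → Fin d → ℕ) (e : ℕ) : Prop :=
  1 ≤ e ∧ e ≤ D ∧ e ∣ D ∧
    (0 : Fin d → ℕ) ∈ Set.range a ∧
    (∀ i j : Fin d, (Pi.single i (D - 1) + Pi.single j 1 : Fin d → ℕ) ∈ Set.range a) ∧
    (∀ i : Fin d, (Pi.single i (D - e) : Fin d → ℕ) ∈ Set.range a) ∧
    (∀ i, e ∣ size (a i)) ∧
    (e = 1 → ∃ j : Fin d, (Pi.single j 1 : Fin d → ℕ) ∉ Set.range a)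

/-- The asymptotic structure of the sumsets of `A = {a₀, …, aₙ}`, for a given `e`. -/
def SumsetStructure {d n : ℕ} (D : ℕ) (a : Fin (n + 1) → Fin d → ℕ) (e : ℕ) : Prop :=
  1 ≤ e ∧ ∃ H : Set (Fin d → ℕ), H.Finite ∧ H ⊆ latticeMod d e ∧ (e = 1 → H.Nonempty) ∧
    ∃ s₀ : ℕ, ∀ s, s₀ ≤ s → sumset s (Set.range a) = simplexMod d D s e \ H

end OneSing

end

open MvPolynomial

noncomputable section

namespace OneSing

/-! Smoothness is read off at the vertices of the simplex with corners `D εⱼ`. The coordinate ring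
has dimension `m = d + 1` because `k[t]` is integral over it. At the point of a vertex, the Jacobian
columns of the vertex and of every irreducible generator of the local semigroup vanish
(`eval_pderiv_of_isVertexIrreducible`, `eval_pderiv_vertex`). Smoothness therefore leaves only one
generator per edge, and each edge step `g` divides its whole column (`exists_edge_of_le_finrank`).
Conversely, such edges supply enough binomials for smoothness wherever the coordinate of the vertex
is nonzero (`le_finrank_jacobianSpan_of_edges`). Every point except `(1:0:⋯:0)` lies in the chart of
some vertex `D εᵢ` with `i ≥ 1`. Smoothness at these vertices, with gcd 1, forces step 1 along the
edges joining them and a common step `e` towards vertex 0. Vertex 0 is smooth exactly when all its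
edges have step 1, which would give `e = 1` and all `ε'ⱼ ∈ A`. For the sumsets, a vector with one
large coordinate can be written greedily with as few summands as its size permits
(`mem_sumset_of_large`), so exceptions lie in a finite box. Conversely, a required element
translated by many copies of `D ε'ᵢ` escapes the exceptional set, and counting sizes in a
decomposition exposes that element as a summand. -/

/-! ### Krull dimension of integral extensions -/

/-- Going up for a whole chain of primes. -/
theorem exists_ltSeries_of_isIntegral {R S : Type*} [CommRing R] [CommRing S] [Algebra R S]
    [Algebra.IsIntegral R S] (hinj : Function.Injective (algebraMap R S)) (m : ℕ) :
    ∀ l : LTSeries (PrimeSpectrum R), l.length = m →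
      ∃ l' : LTSeries (PrimeSpectrum S), l'.length = m ∧
        l'.last.asIdeal.comap (algebraMap R S) = l.last.asIdeal := by
  induction m with
  | zero =>
    intro l _
    obtain ⟨Q, -, hQ, hQl⟩ := Ideal.exists_ideal_over_prime_of_isIntegral l.last.asIdeal
      (⊥ : Ideal S) (by
        rw [← RingHom.ker_eq_comap_bot, (RingHom.injective_iff_ker_eq_bot _).mp hinj]
        exact bot_le)
    exact ⟨RelSeries.singleton _ ⟨Q, hQ⟩, rfl, by simpa using hQl⟩
  | succ m ih =>
    intro l hl
    obtain ⟨l', hl', hlast⟩ := ih l.eraseLast (by simp [hl])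
    have hlt : l.eraseLast.last < l.last :=
      RelSeries.eraseLast_last_rel_last l (by omega)
    obtain ⟨Q, hQ, hQp, hQl⟩ := Ideal.exists_ideal_over_prime_of_isIntegral_of_isPrime
      l.last.asIdeal l'.last.asIdeal (by rw [hlast]; exact hlt.le)
    have hlt' : l'.last < ⟨Q, hQp⟩ := by
      refine lt_of_le_of_ne hQ ?_
      intro h
      apply hlt.ne
      ext1
      rw [← hlast, ← hQl, h]
    exact ⟨l'.snoc ⟨Q, hQp⟩ hlt', by simp [hl'], by simpa using hQl⟩

/-- Going up lifts chains of primes to `S`; incomparability keeps contracted chains strict. -/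
theorem ringKrullDim_eq_of_isIntegral {R S : Type*} [CommRing R] [CommRing S] (f : R →+* S)
    (hf : f.IsIntegral) (hinj : Function.Injective f) : ringKrullDim R = ringKrullDim S := by
  algebraize [f]
  apply le_antisymm
  · refine iSup_le fun l => ?_
    obtain ⟨l', hl', -⟩ := exists_ltSeries_of_isIntegral (S := S) hinj l.length l rfl
    rw [← hl']
    exact Order.LTSeries.length_le_krullDim l'
  · exact Order.krullDim_le_of_strictMono (PrimeSpectrum.comap (algebraMap R S))
      fun I J h => Ideal.IsIntegral.comap_lt_comap (R := R) h

/-! ### Toric ideals -/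

section Toric

variable {k : Type*} [Field k] {n m : ℕ} (b : Fin (n + 1) → Fin m → ℕ)

/-- The exponent of the image of the monomial `x^u` under `xᵢ ↦ t^(bᵢ)`. -/
def toricExponent (u : Fin (n + 1) →₀ ℕ) : Fin m →₀ ℕ :=
  Finsupp.equivFunOnFinite.symm fun j => ∑ i, u i * b i j

@[simp]
theorem toricExponent_apply (u : Fin (n + 1) →₀ ℕ) (j : Fin m) :
    toricExponent b u j = ∑ i, u i * b i j := rfl

theorem aeval_monomial_toric (u : Fin (n + 1) →₀ ℕ) :
    aeval (fun i => ∏ j, X j ^ b i j : Fin (n + 1) → MvPolynomial (Fin m) k) (monomial u (1 : k)) =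
      monomial (toricExponent b u) 1 := by
  rw [aeval_monomial, map_one, one_mul, Finsupp.prod_fintype _ _ (by simp), monomial_eq, map_one,
    one_mul, Finsupp.prod_fintype _ _ (by simp)]
  simp_rw [toricExponent_apply, ← Finset.prod_pow, ← pow_mul]
  rw [Finset.prod_comm]
  simp_rw [Finset.prod_pow_eq_pow_sum, mul_comm]

theorem monomial_sub_monomial_mem_toricIdeal {u u' : Fin (n + 1) →₀ ℕ}
    (h : ∀ j, ∑ i, u i * b i j = ∑ i, u' i * b i j) :
    monomial u 1 - monomial u' 1 ∈ toricIdeal k b := by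
  have : toricExponent b u = toricExponent b u' := by ext j; simpa using h j
  rw [toricIdeal, RingHom.mem_ker, map_sub, aeval_monomial_toric, aeval_monomial_toric, this,
    sub_self]

instance toricIdeal_isPrime : (toricIdeal k b).IsPrime :=
  RingHom.ker_isPrime _

variable {b}

/-- The quotient embeds in `k[t₁, …, t_m]`, integrally, since each `tⱼ ^ D` is the image of a
variable. -/
theorem ringKrullDim_quotient_toricIdeal {D : ℕ} (hD : D ≠ 0)
    (hvert : ∀ j, Pi.single j D ∈ Set.range b) :
    ringKrullDim (MvPolynomial (Fin (n + 1)) k ⧸ toricIdeal k b) = m := by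
  let φ : MvPolynomial (Fin (n + 1)) k →+* MvPolynomial (Fin m) k :=
    (aeval (fun i => ∏ j, X j ^ b i j) : MvPolynomial (Fin (n + 1)) k →ₐ[k] _).toRingHom
  have key := ringKrullDim_eq_of_isIntegral (RingHom.kerLift φ) ?_ (RingHom.kerLift_injective φ)
  · refine key.trans ?_
    rw [MvPolynomial.ringKrullDim_of_isNoetherianRing, ringKrullDim_eq_zero_of_field]
    simp
  · have himg : ∀ x, (RingHom.kerLift φ).IsIntegralElem (φ x) := fun x => by
      rw [← RingHom.kerLift_mk φ x]
      exact RingHom.isIntegralElem_map _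
    intro p
    induction p using MvPolynomial.induction_on with
    | C c => simpa [φ] using himg (C c)
    | add p q hp hq => exact hp.add _ hq
    | mul_X p j hp =>
      refine hp.mul _ ?_
      obtain ⟨i, hi⟩ := hvert j
      have h1 : φ (X i) = X j ^ D := by
        simp only [φ, AlgHom.toRingHom_eq_coe, RingHom.coe_coe, aeval_X, hi]
        rw [Finset.prod_eq_single j] <;> simp +contextual
      have h2 := himg (X i)
      rw [h1] at h2
      let _ := (RingHom.kerLift φ).toAlgebra
      exact IsIntegral.of_pow (R := MvPolynomial (Fin (n + 1)) k ⧸ RingHom.ker φ)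
        (Nat.pos_of_ne_zero hD) h2

/-- With `c = z ^ D`, scaling all `xᵢ` by `c` corresponds to scaling all `tⱼ` by `z`, because every
row has sum `D`. -/
theorem smul_mem_zeroLocus_toricIdeal [IsAlgClosed k] {D : ℕ} (hD : D ≠ 0)
    (hsum : ∀ i, ∑ j, b i j = D) {v : Fin (n + 1) → k} (hv : v ∈ zeroLocus k (toricIdeal k b))
    (c : k) : c • v ∈ zeroLocus k (toricIdeal k b) := by
  obtain ⟨z, hz⟩ := IsAlgClosed.exists_pow_nat_eq c (Nat.pos_of_ne_zero hD)
  intro f hf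
  let σ : MvPolynomial (Fin (n + 1)) k →ₐ[k] MvPolynomial (Fin (n + 1)) k :=
    aeval fun i => C c * X i
  let τ : MvPolynomial (Fin m) k →ₐ[k] MvPolynomial (Fin m) k := aeval fun j => C z * X j
  let φ : MvPolynomial (Fin (n + 1)) k →ₐ[k] MvPolynomial (Fin m) k :=
    aeval fun i => ∏ j, X j ^ b i j
  have h1 : φ.comp σ = τ.comp φ := by
    ext1 i
    simp only [σ, τ, φ, AlgHom.comp_apply, aeval_X, map_mul, map_prod, map_pow, mul_pow,
      Finset.prod_mul_distrib, Finset.prod_pow_eq_pow_sum, hsum]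
    rw [← map_pow, hz, ← algebraMap_eq, ← algebraMap_eq, AlgHom.commutes]
  have h2 : σ f ∈ toricIdeal k b := by
    have hf' : φ f = 0 := hf
    change φ (σ f) = 0
    rw [← AlgHom.comp_apply, h1, AlgHom.comp_apply, hf', map_zero]
  have h3 : (aeval v).comp σ = aeval (c • v) := by
    ext1 i
    simp [σ]
  rw [← h3, AlgHom.comp_apply]
  exact hv _ h2

theorem mem_toricVariety_iff [IsAlgClosed k] {D : ℕ} (hD : D ≠ 0) (hsum : ∀ i, ∑ j, b i j = D)
    {P : Projectivization k (Fin (n + 1) → k)} :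
    P ∈ toricVariety k b ↔ P.rep ∈ zeroLocus k (toricIdeal k b) := by
  constructor
  · intro h
    apply h
    rw [P.submodule_eq]
    exact Submodule.mem_span_singleton_self _
  · intro h v hv
    rw [P.submodule_eq, SetLike.mem_coe, Submodule.mem_span_singleton] at hv
    obtain ⟨c, rfl⟩ := hv
    exact smul_mem_zeroLocus_toricIdeal hD hsum h c

theorem mk_mem_toricVariety [IsAlgClosed k] {D : ℕ} (hD : D ≠ 0) (hsum : ∀ i, ∑ j, b i j = D)
    {v : Fin (n + 1) → k} (hv : v ≠ 0) (h : v ∈ zeroLocus k (toricIdeal k b)) :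
    Projectivization.mk k v hv ∈ toricVariety k b := by
  intro w hw
  rw [Projectivization.submodule_mk, SetLike.mem_coe, Submodule.mem_span_singleton] at hw
  obtain ⟨c, rfl⟩ := hw
  exact smul_mem_zeroLocus_toricIdeal hD hsum h c

/-- The vertices of the polytope give points of the toric variety. -/
theorem single_mem_zeroLocus_toricIdeal {D : ℕ} (hb : Function.Injective b)
    (hsum : ∀ i, ∑ j, b i j = D) {p : Fin (n + 1)} {q : Fin m} (hp : b p = Pi.single q D) :
    Pi.single p 1 ∈ zeroLocus k (toricIdeal k b) := by
  intro f hf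
  let τ : MvPolynomial (Fin m) k →ₐ[k] k := aeval (Pi.single q 1)
  have h : (aeval (Pi.single p 1 : Fin (n + 1) → k)) =
      τ.comp (aeval fun i => ∏ j, X j ^ b i j) := by
    ext1 i
    simp only [τ, AlgHom.comp_apply, aeval_X, map_prod, map_pow]
    by_cases hi : i = p
    · subst hi
      rw [Pi.single_eq_same, eq_comm]
      apply Finset.prod_eq_one
      intro j _
      by_cases hj : j = q
      · simp [hj]
      · simp [hp, hj]
    · rw [Pi.single_eq_of_ne hi]
      have : ∃ j, j ≠ q ∧ b i j ≠ 0 := by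
        by_contra! hcon
        apply hi
        apply hb
        rw [hp]
        have hq : b i q = D := by
          rw [← hsum i, Finset.sum_eq_single q] <;> simp +contextual [hcon]
        ext j
        by_cases hj : j = q
        · subst hj; simpa using hq
        · simp [hj, hcon j hj]
      obtain ⟨j, hj, hbj⟩ := this
      rw [eq_comm]
      exact Finset.prod_eq_zero (Finset.mem_univ j) (by simp [hj, hbj])
  rw [h, AlgHom.comp_apply]
  have hf' : aeval (fun i => ∏ j, X j ^ b i j : Fin (n + 1) → MvPolynomial (Fin m) k) f = 0 := hf
  rw [hf', map_zero]

/-- The Nullstellensatz for a prime ideal. Nonemptiness puts the origin in the affine cone. -/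
theorem projVanishingIdeal_toricVariety [IsAlgClosed k] {D : ℕ} (hD : D ≠ 0)
    (hsum : ∀ i, ∑ j, b i j = D) (hne : (toricVariety k b).Nonempty) :
    projVanishingIdeal (toricVariety k b) = toricIdeal k b := by
  have : affineCone (toricVariety k b) = zeroLocus k (toricIdeal k b) := by
    ext v
    constructor
    · rintro ⟨P, hP, hv⟩
      exact hP hv
    · intro hv
      by_cases h0 : v = 0
      · obtain ⟨P, hP⟩ := hne
        exact ⟨P, hP, by simp [h0]⟩
      · refine ⟨_, mk_mem_toricVariety hD hsum h0 hv, ?_⟩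
        rw [Projectivization.submodule_mk]
        exact Submodule.mem_span_singleton_self _
  rw [projVanishingIdeal, this, IsPrime.vanishingIdeal_zeroLocus]

theorem isSingularPoint_toricVariety_iff [IsAlgClosed k] {D : ℕ} (hD : D ≠ 0)
    (hsum : ∀ i, ∑ j, b i j = D) (hvert : ∀ j, Pi.single j D ∈ Set.range b)
    (P : Projectivization k (Fin (n + 1) → k)) :
    IsSingularPoint (toricVariety k b) P ↔ P ∈ toricVariety k b ∧
      Module.finrank k (jacobianSpan (toricIdeal k b) P.rep) + m < n + 1 := by
  refine and_congr_right fun hP => ?_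
  rw [projVanishingIdeal_toricVariety hD hsum ⟨P, hP⟩, ringKrullDim_quotient_toricIdeal hD hvert]
  norm_cast

/-- If, up to a nonvanishing coordinate, every coordinate is a monomial in the coordinates indexed
by `B`, then the Jacobian matrix has corank at most `#B`. -/
theorem le_finrank_jacobianSpan_add {r : ℕ} (v : Fin (n + 1) → k) (B : Fin r → Fin (n + 1))
    (q : Fin r) (hq : v (B q) ≠ 0)
    (hB : ∀ l, ∃ (N : ℕ) (c : Fin r → ℕ), ∀ j, b l j + N * b (B q) j = ∑ t, c t * b (B t) j) :
    n + 1 ≤ Module.finrank k (jacobianSpan (toricIdeal k b) v) + r := by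
  classical
  set J := jacobianSpan (toricIdeal k b) v
  set W : Submodule k (Fin (n + 1) → k) :=
    Submodule.span k (Set.range fun t => Pi.single (B t) (1 : k))
  have hW : Module.finrank k W ≤ r := by
    have h := finrank_range_le_card (R := k) fun t => (Pi.single (B t) 1 : Fin (n + 1) → k)
    rwa [Fintype.card_fin] at h
  have htop : J ⊔ W = ⊤ := by
    rw [eq_top_iff, ← (Pi.basisFun k (Fin (n + 1))).span_eq, Submodule.span_le]
    rintro _ ⟨l, rfl⟩
    rw [Pi.basisFun_apply, SetLike.mem_coe]
    by_cases hl : ∃ t, B t = l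
    · obtain ⟨t, rfl⟩ := hl
      exact Submodule.mem_sup_right (Submodule.subset_span ⟨t, rfl⟩)
    push Not at hl
    obtain ⟨N, c, hc⟩ := hB l
    -- The gradient of `x_l x_{B q}^N - ∏ x_{B t}^{c t}` at `v` has entry `v (B q) ^ N ≠ 0` at `l`;
    -- its other nonzero entries are at indices in `B`. So modulo `W` it is a nonzero multiple of
    -- the `l`-th basis vector.
    let u : Fin (n + 1) →₀ ℕ := Finsupp.single l 1 + Finsupp.single (B q) N
    let u' : Fin (n + 1) →₀ ℕ := ∑ t, Finsupp.single (B t) (c t)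
    have hf : monomial u 1 - monomial u' 1 ∈ toricIdeal k b := by
      apply monomial_sub_monomial_mem_toricIdeal
      intro j
      simp only [u, u', Finsupp.add_apply, Finsupp.finsetSum_apply, Finsupp.single_apply, add_mul,
        Finset.sum_add_distrib, Finset.sum_mul, ite_mul, one_mul, zero_mul]
      rw [Finset.sum_comm]
      simpa using hc j
    set f : MvPolynomial (Fin (n + 1)) k := monomial u 1 - monomial u' 1
    let g : Fin (n + 1) → k := fun i => eval v (pderiv i f)
    have hg : g ∈ J := Submodule.subset_span ⟨f, hf, rfl⟩
    have hgl : g l = v (B q) ^ N := by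
      have h1 : u' l = 0 := by simp [u', hl]
      have h2 : u l = 1 := by simp [u, hl q]
      have h3 : u - Finsupp.single l 1 = Finsupp.single (B q) N := by simp [u]
      simp only [g, f, map_sub, pderiv_monomial, h1, h2, h3]
      simp [eval_monomial]
    have hgi : ∀ i, i ≠ l → (∀ t, B t ≠ i) → g i = 0 := by
      intro i hil hi
      have h1 : u' i = 0 := by simp [u', hi]
      have h2 : u i = 0 := by simp [u, hi q, hil.symm]
      simp only [g, f, map_sub, pderiv_monomial, h1, h2]
      simp
    have hrest : g - g l • Pi.single l 1 ∈ W := by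
      rw [← (Pi.basisFun k (Fin (n + 1))).sum_repr (g - g l • Pi.single l 1)]
      refine Submodule.sum_mem _ fun i _ => ?_
      by_cases hi : ∃ t, B t = i
      · obtain ⟨t, rfl⟩ := hi
        refine Submodule.smul_mem _ _ (Submodule.subset_span ⟨t, by simp⟩)
      · push Not at hi
        have : (g - g l • Pi.single l 1 : Fin (n + 1) → k) i = 0 := by
          by_cases hil : i = l
          · subst hil; simp
          · simp [hgi i hil hi, hil]
        rw [Pi.basisFun_repr, this, zero_smul]
        exact zero_mem _
    have hgl0 : g l ≠ 0 := by rw [hgl]; exact pow_ne_zero _ hq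
    have : (Pi.single l 1 : Fin (n + 1) → k) = (g l)⁻¹ • (g - (g - g l • Pi.single l 1)) := by
      rw [sub_sub_cancel, inv_smul_smul₀ hgl0]
    rw [this]
    exact Submodule.smul_mem _ _ (Submodule.sub_mem _ (Submodule.mem_sup_left hg)
      (Submodule.mem_sup_right hrest))
  calc n + 1 = Module.finrank k (⊤ : Submodule k (Fin (n + 1) → k)) := by simp
    _ = Module.finrank k ↥(J ⊔ W) := by rw [htop]
    _ ≤ Module.finrank k J + Module.finrank k W := Submodule.finrank_add_le_finrank_add_finrank _ _
    _ ≤ _ := by omega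

end Toric

/-! ### Local semigroups and Jacobian columns at a vertex -/

section Vertex

variable {k : Type*} [Field k] {n m : ℕ} {b : Fin (n + 1) → Fin m → ℕ} {D : ℕ}

/-- A partial derivative at a point that only depends on the toric exponent of a monomial vanishes
on the toric ideal. -/
theorem eval_pderiv_eq_zero_of_toricExponent (v : Fin (n + 1) → k) (l : Fin (n + 1))
    (g : (Fin m →₀ ℕ) → k)
    (hg : ∀ u, eval v (pderiv l (monomial u (1 : k))) = g (toricExponent b u))
    {f : MvPolynomial (Fin (n + 1)) k} (hf : f ∈ toricIdeal k b) : eval v (pderiv l f) = 0 := by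
  let φ : MvPolynomial (Fin (n + 1)) k →ₐ[k] MvPolynomial (Fin m) k :=
    aeval fun i => ∏ j, X j ^ b i j
  let L : MvPolynomial (Fin m) k →ₗ[k] k := (basisMonomials (Fin m) k).constr k g
  have h : (aeval v).toLinearMap ∘ₗ (pderiv l : Derivation k _ _).toLinearMap =
      L ∘ₗ φ.toLinearMap := by
    refine (basisMonomials (Fin (n + 1)) k).ext fun u => ?_
    have h1 : L (monomial (toricExponent b u) 1) = g (toricExponent b u) := by
      have := (basisMonomials (Fin m) k).constr_basis k g (toricExponent b u)
      rwa [coe_basisMonomials] at this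
    have h2 : φ (monomial u 1) = monomial (toricExponent b u) 1 := aeval_monomial_toric b u
    rw [coe_basisMonomials]
    change aeval v (pderiv l (monomial u (1 : k))) = L (φ (monomial u 1))
    rw [h2, h1, ← hg u]
    rfl
  have h3 := LinearMap.congr_fun h f
  change aeval v (pderiv l f) = L (φ f) at h3
  have hf' : φ f = 0 := hf
  rw [hf', map_zero] at h3
  exact h3

theorem sum_toricExponent (hsum : ∀ i, ∑ j, b i j = D) (u : Fin (n + 1) →₀ ℕ) :
    ∑ j, toricExponent b u j = (∑ i, u i) * D := by
  simp only [toricExponent_apply]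
  rw [Finset.sum_comm, Finset.sum_mul]
  simp_rw [← Finset.mul_sum, hsum]

/-- Rows with equal sums are determined by their entries off one column. -/
theorem eq_of_forall_ne_eq (hb : Function.Injective b) (hsum : ∀ i, ∑ j, b i j = D) {q : Fin m}
    {i l : Fin (n + 1)} (h : ∀ j, j ≠ q → b i j = b l j) : i = l := by
  apply hb
  ext j
  by_cases hj : j = q
  · subst hj
    have h1 := hsum i
    rw [← hsum l, ← Finset.add_sum_erase _ _ (Finset.mem_univ j),
      ← Finset.add_sum_erase _ (b l) (Finset.mem_univ j)] at h1
    rw [Finset.sum_congr rfl fun x hx => h x (Finset.ne_of_mem_erase hx)] at h1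
    exact Nat.add_right_cancel h1
  · exact h j hj

/-- `bₗ - bₚ` is irreducible in the semigroup generated by the `bᵢ - bₚ`, where `bₚ` is a multiple
of the basis vector number `q` (so that only the entries off column `q` need to be compared). -/
def IsVertexIrreducible (b : Fin (n + 1) → Fin m → ℕ) (p : Fin (n + 1)) (q : Fin m)
    (l : Fin (n + 1)) : Prop :=
  l ≠ p ∧ ∀ u : Fin (n + 1) → ℕ, (∀ j, j ≠ q → ∑ i, u i * b i j = b l j) →
    ∀ i, i ≠ p → u i = if i = l then 1 else 0

theorem eval_single_monomial {p : Fin (n + 1)} (c : k) (u : Fin (n + 1) →₀ ℕ) :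
    eval (Pi.single p c) (monomial u (1 : k)) = if ∀ i, i ≠ p → u i = 0 then c ^ u p else 0 := by
  rw [eval_monomial, one_mul, Finsupp.prod_fintype _ _ (by simp)]
  split_ifs with h
  · rw [Finset.prod_eq_single p]
    · simp
    · intro i _ hi
      simp [h i hi]
    · simp
  · push Not at h
    obtain ⟨i, hi, hu⟩ := h
    exact Finset.prod_eq_zero (Finset.mem_univ i) (by simp [hi, hu])

/-- The derivative of `x^u` survives at the vertex only if `x^u = x_l x_p^N`. Irreducibility makes
this visible in the toric exponent, and `N` is the degree `(∑ s) / D` minus one. The surviving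
coefficient is 1, so the characteristic plays no role. -/
theorem eval_pderiv_of_isVertexIrreducible (hD : D ≠ 0) (hsum : ∀ i, ∑ j, b i j = D)
    {p : Fin (n + 1)} {q : Fin m} (hp : b p = Pi.single q D) (c : k) {l : Fin (n + 1)}
    (hl : IsVertexIrreducible b p q l) {f : MvPolynomial (Fin (n + 1)) k}
    (hf : f ∈ toricIdeal k b) : eval (Pi.single p c) (pderiv l f) = 0 := by
  classical
  refine eval_pderiv_eq_zero_of_toricExponent (b := b) _ l
    (fun s => if ∀ j, j ≠ q → s j = b l j then c ^ ((∑ j, s j) / D - 1) else 0) (fun u => ?_) hf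
  have hmon : monomial (u - Finsupp.single l 1) (1 * (u l : k)) =
      C (u l : k) * monomial (u - Finsupp.single l 1) 1 := by
    rw [C_mul_monomial, one_mul, mul_one]
  rw [pderiv_monomial, hmon, map_mul, eval_C, eval_single_monomial, sum_toricExponent hsum,
    Nat.mul_div_cancel _ (Nat.pos_of_ne_zero hD)]
  have hcol : ∀ j, j ≠ q → b p j = 0 := fun j hj => by simp [hp, hj]
  by_cases h : ∀ j, j ≠ q → toricExponent b u j = b l j
  · rw [if_pos h]
    have hu := hl.2 u h
    have hul : u l = 1 := by simpa using hu l hl.1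
    rw [if_pos, hul, Nat.cast_one, one_mul]
    · congr 1
      have : ∑ i, u i = u p + 1 := by
        rw [← Finset.add_sum_erase _ _ (Finset.mem_univ p),
          Finset.sum_congr rfl fun i hi => hu i (Finset.ne_of_mem_erase hi)]
        simp [hl.1]
      rw [this]
      simp [hl.1]
    · intro i hi
      have := hu i hi
      by_cases hil : i = l
      · subst hil; simp [hul]
      · simp [this, hil]
  · rw [if_neg h]
    by_cases hul : u l = 0
    · simp [hul]
    rw [if_neg, mul_zero]
    intro hu
    apply h
    intro j hj
    have h1 : u l = 1 := by
      have := hu l hl.1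
      simp at this
      omega
    rw [toricExponent_apply, Finset.sum_eq_single l, h1, one_mul]
    · intro i _ hil
      by_cases hip : i = p
      · simp [hip, hcol j hj]
      · have := hu i hip
        simp [Ne.symm hil] at this
        simp [this]
    · simp

/-- Only pure powers of `x_p` contribute, and they are the monomials whose toric exponent is
supported on column `q`. The factor `u p` is then the degree. -/
theorem eval_pderiv_vertex (hb : Function.Injective b) (hD : D ≠ 0) (hsum : ∀ i, ∑ j, b i j = D)
    {p : Fin (n + 1)} {q : Fin m} (hp : b p = Pi.single q D) (c : k)
    {f : MvPolynomial (Fin (n + 1)) k} (hf : f ∈ toricIdeal k b) :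
    eval (Pi.single p c) (pderiv p f) = 0 := by
  classical
  refine eval_pderiv_eq_zero_of_toricExponent (b := b) _ p
    (fun s => if ∀ j, j ≠ q → s j = 0 then
      (((∑ j, s j) / D : ℕ) : k) * c ^ ((∑ j, s j) / D - 1) else 0) (fun u => ?_) hf
  have hmon : monomial (u - Finsupp.single p 1) (1 * (u p : k)) =
      C (u p : k) * monomial (u - Finsupp.single p 1) 1 := by
    rw [C_mul_monomial, one_mul, mul_one]
  rw [pderiv_monomial, hmon, map_mul, eval_C, eval_single_monomial, sum_toricExponent hsum,
    Nat.mul_div_cancel _ (Nat.pos_of_ne_zero hD)]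
  have hcol : ∀ j, j ≠ q → b p j = 0 := fun j hj => by simp [hp, hj]
  have hiff : (∀ i, i ≠ p → (u - Finsupp.single p 1 : Fin (n + 1) →₀ ℕ) i = 0) ↔
      ∀ j, j ≠ q → toricExponent b u j = 0 := by
    have : ∀ i, i ≠ p → (u - Finsupp.single p 1 : Fin (n + 1) →₀ ℕ) i = u i := fun i hi => by
      simp [Ne.symm hi]
    constructor
    · intro h j hj
      rw [toricExponent_apply]
      refine Finset.sum_eq_zero fun i _ => ?_
      by_cases hip : i = p
      · simp [hip, hcol j hj]
      · rw [← this i hip, h i hip, zero_mul]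
    · intro h i hi
      rw [this i hi]
      by_contra hu
      apply hi
      apply eq_of_forall_ne_eq hb hsum (q := q)
      intro j hj
      have h2 := h j hj
      rw [toricExponent_apply, Finset.sum_eq_zero_iff] at h2
      rw [hcol j hj]
      exact (Nat.mul_eq_zero.mp (h2 i (Finset.mem_univ i))).resolve_left hu
  by_cases h : ∀ j, j ≠ q → toricExponent b u j = 0
  · rw [if_pos h, if_pos (hiff.mpr h)]
    have : ∑ i, u i = u p := by
      rw [Finset.sum_eq_single p]
      · intro i _ hi
        have := hiff.mpr h i hi
        simpa [Ne.symm hi] using this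
      · simp
    rw [this]
    simp
  · rw [if_neg h, if_neg (mt hiff.mp h), mul_zero]

theorem finrank_jacobianSpan_add_card_le (I : Ideal (MvPolynomial (Fin (n + 1)) k))
    (v : Fin (n + 1) → k) (T : Finset (Fin (n + 1)))
    (hT : ∀ l ∈ T, ∀ f ∈ I, eval v (pderiv l f) = 0) :
    Module.finrank k (jacobianSpan I v) + T.card ≤ n + 1 := by
  let R : (Fin (n + 1) → k) →ₗ[k] (T → k) := LinearMap.funLeft k k Subtype.val
  have hR : Function.Surjective R :=
    LinearMap.funLeft_surjective_of_injective k k _ Subtype.val_injective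
  have hle : jacobianSpan I v ≤ LinearMap.ker R := by
    rw [jacobianSpan, Submodule.span_le]
    rintro _ ⟨f, hf, rfl⟩
    rw [SetLike.mem_coe, LinearMap.mem_ker]
    ext l
    exact hT l l.2 f hf
  have h1 := LinearMap.finrank_range_add_finrank_ker R
  rw [LinearMap.range_eq_top.mpr hR, finrank_top] at h1
  have h2 := Submodule.finrank_mono hle
  simp at h1
  omega

/-- A decomposition of a vector on an edge uses only rows on that edge; each such row other than `p`
already takes at least `c`, leaving no room for a second one. -/
theorem isVertexIrreducible_of_minimal (hb : Function.Injective b) (hsum : ∀ i, ∑ j, b i j = D)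
    {p : Fin (n + 1)} {q : Fin m} (hp : b p = Pi.single q D) {j : Fin m} (hj : j ≠ q) {c : ℕ}
    (hc : c ≠ 0) {l : Fin (n + 1)} (hl : b l = Pi.single q (D - c) + Pi.single j c)
    (hmin : ∀ i, b i j ≠ 0 → (∀ j', j' ≠ q → j' ≠ j → b i j' = 0) → c ≤ b i j) :
    IsVertexIrreducible b p q l := by
  have hcol : ∀ j, j ≠ q → b p j = 0 := fun j hj => by simp [hp, hj]
  have hlj : b l j = c := by simp [hl, hj]
  have hlj' : ∀ j', j' ≠ q → j' ≠ j → b l j' = 0 := fun j' h1 h2 => by simp [hl, h1, h2]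
  have hlp : l ≠ p := by
    rintro rfl
    exact hc (hlj ▸ hcol j hj)
  refine ⟨hlp, fun u hu => ?_⟩
  have hzero : ∀ i, i ≠ p → i ≠ l → u i = 0 := by
    intro i hip hil
    by_contra hui
    have h1 : ∀ j', j' ≠ q → j' ≠ j → b i j' = 0 := by
      intro j' hq' hjj'
      have h := hu j' hq'
      rw [hlj' j' hq' hjj', Finset.sum_eq_zero_iff] at h
      exact (Nat.mul_eq_zero.mp (h i (Finset.mem_univ i))).resolve_left hui
    have h2 : b i j ≠ 0 := by
      intro h0
      apply hip
      apply eq_of_forall_ne_eq hb hsum (q := q)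
      intro j' hq'
      rw [hcol j' hq']
      by_cases hjj' : j' = j
      · rw [hjj', h0]
      · exact h1 j' hq' hjj'
    have h3 := hmin i h2 h1
    have h4 : u i * b i j ≤ c := by
      rw [← hlj, ← hu j hj]
      exact Finset.single_le_sum (f := fun i => u i * b i j) (fun _ _ => Nat.zero_le _)
        (Finset.mem_univ i)
    have h5 : b i j ≤ u i * b i j := Nat.le_mul_of_pos_left _ (Nat.pos_of_ne_zero hui)
    apply hil
    apply eq_of_forall_ne_eq hb hsum (q := q)
    intro j' hq'
    by_cases hjj' : j' = j
    · rw [hjj', hlj]; omega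
    · rw [h1 j' hq' hjj', hlj' j' hq' hjj']
  intro i hip
  split_ifs with hil
  · subst hil
    have h := hu j hj
    rw [Finset.sum_eq_single i, hlj] at h
    · exact Nat.eq_of_mul_eq_mul_right (Nat.pos_of_ne_zero hc) (by rw [h, one_mul])
    · intro i' _ hi'
      by_cases hip' : i' = p
      · simp [hip', hcol j hj]
      · simp [hzero i' hip' hi']
    · simp
  · exact hzero i hip hil

/-- If the column-`j` entries of the irreducible rows are divisible by `g`, then so are those of all
rows. -/
theorem dvd_of_forall_isVertexIrreducible (hb : Function.Injective b) (hsum : ∀ i, ∑ j, b i j = D)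
    {p : Fin (n + 1)} {q : Fin m} (hp : b p = Pi.single q D) {j : Fin m} (hj : j ≠ q) {g : ℕ}
    (hg : ∀ l, IsVertexIrreducible b p q l → g ∣ b l j) (l : Fin (n + 1)) : g ∣ b l j := by
  have hcol : ∀ j, j ≠ q → b p j = 0 := fun j hj => by simp [hp, hj]
  induction hw : ∑ j ∈ Finset.univ.erase q, b l j using Nat.strong_induction_on generalizing l with
  | _ w ih =>
  by_cases hlp : l = p
  · simp [hlp, hcol j hj]
  by_cases hirr : IsVertexIrreducible b p q l
  · exact hg l hirr
  simp only [IsVertexIrreducible, ne_eq, hlp, not_false_eq_true, true_and] at hirr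
  push Not at hirr
  obtain ⟨u, hu, i₀, hi₀, hui₀⟩ := hirr
  rw [← hu j hj]
  refine Finset.dvd_sum fun i _ => ?_
  by_cases hui : u i = 0
  · simp [hui]
  by_cases hip : i = p
  · simp [hip, hcol j hj]
  refine Dvd.dvd.mul_left (ih _ ?_ i rfl) _
  have hle : ∀ j', j' ≠ q → b i j' ≤ b l j' := by
    intro j' hj'
    rw [← hu j' hj']
    exact (Nat.le_mul_of_pos_left _ (Nat.pos_of_ne_zero hui)).trans
      (Finset.single_le_sum (f := fun i => u i * b i j') (fun _ _ => Nat.zero_le _)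
        (Finset.mem_univ i))
  rw [← hw]
  refine lt_of_le_of_ne (Finset.sum_le_sum fun j' h => hle j' (Finset.ne_of_mem_erase h)) ?_
  intro heq
  have heq' := (Finset.sum_eq_sum_iff_of_le fun j' h => hle j' (Finset.ne_of_mem_erase h)).mp heq
  have hil : i = l := eq_of_forall_ne_eq hb hsum (q := q) fun j' h => heq' j' (by simp [h])
  subst hil
  have hnz : ∀ i', i' ≠ p → ∃ j', j' ≠ q ∧ b i' j' ≠ 0 := by
    intro i' hi'
    by_contra! hcon
    exact hi' (eq_of_forall_ne_eq hb hsum (q := q) fun j' h => by rw [hcon j' h, hcol j' h])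
  -- Row `l` occurs in its own decomposition. The failure at `i₀` means that it occurs twice or that
  -- another row occurs too, and then some column total is too large.
  by_cases h0 : i₀ = i
  · subst h0
    rw [if_pos rfl] at hui₀
    obtain ⟨j', hj', hbj'⟩ := hnz i₀ hi₀
    have h1 := Finset.single_le_sum (f := fun i => u i * b i j') (fun _ _ => Nat.zero_le _)
        (Finset.mem_univ i₀)
    rw [hu j' hj'] at h1
    have h2 : 2 * b i₀ j' ≤ u i₀ * b i₀ j' := Nat.mul_le_mul_right _ (by omega)
    omega
  · rw [if_neg h0] at hui₀
    obtain ⟨j', hj', hbj'⟩ := hnz i₀ hi₀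
    have h1 := Finset.add_le_sum (f := fun i => u i * b i j') (fun _ _ => Nat.zero_le _)
        (Finset.mem_univ i₀) (Finset.mem_univ i) h0
    rw [hu j' hj'] at h1
    have h2 : b i j' ≤ u i * b i j' := Nat.le_mul_of_pos_left _ (Nat.pos_of_ne_zero hui)
    have h3 : 0 < u i₀ * b i₀ j' := Nat.mul_pos (Nat.pos_of_ne_zero hui₀) (Nat.pos_of_ne_zero hbj')
    omega

/-- At a smooth vertex the local semigroup is free on the primitive vectors of the edges. -/
theorem exists_edge_of_le_finrank (hb : Function.Injective b) (hD : D ≠ 0)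
    (hsum : ∀ i, ∑ j, b i j = D) (hvert : ∀ j, Pi.single j D ∈ Set.range b)
    {p : Fin (n + 1)} {q : Fin m} (hp : b p = Pi.single q D) (c : k)
    (hreg : n + 1 ≤ Module.finrank k (jacobianSpan (toricIdeal k b) (Pi.single p c)) + m)
    (j : Fin m) (hj : j ≠ q) :
    ∃ g, g ≠ 0 ∧ g ≤ D ∧ (Pi.single q (D - g) + Pi.single j g : Fin m → ℕ) ∈ Set.range b ∧
      ∀ l, g ∣ b l j := by
  classical
  have hcol : ∀ j, j ≠ q → b p j = 0 := fun j hj => by simp [hp, hj]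
  have hedge : ∀ j, j ≠ q → ∃ (g : ℕ) (l : Fin (n + 1)), g ≠ 0 ∧ g ≤ D ∧
      b l = Pi.single q (D - g) + Pi.single j g ∧ IsVertexIrreducible b p q l := by
    intro j hj
    -- `g` will be the least nonzero step along the edge from `q` to `j`; the far vertex shows that
    -- one exists.
    have hex : ∃ g, ∃ i, b i j = g ∧ g ≠ 0 ∧ ∀ j', j' ≠ q → j' ≠ j → b i j' = 0 := by
      obtain ⟨i, hi⟩ := hvert j
      exact ⟨D, i, by simp [hi], hD, fun j' _ h => by simp [hi, h]⟩
    obtain ⟨l, hlg, hg0, hl⟩ := Nat.find_spec hex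
    set g := Nat.find hex
    have hq : b l q + g = D := by
      rw [← hsum l, ← hlg, ← Finset.add_sum_erase _ _ (Finset.mem_univ q),
        Finset.sum_eq_single j]
      · intro j' h1 h2
        exact hl j' (Finset.ne_of_mem_erase h1) h2
      · simp [hj]
    have hbl : b l = Pi.single q (D - g) + Pi.single j g := by
      ext j'
      by_cases h1 : j' = q
      · subst h1
        simp [hj.symm]
        omega
      · by_cases h2 : j' = j
        · subst h2; simp [h1, hlg]
        · simp [h1, h2, hl j' h1 h2]
    refine ⟨g, l, hg0, by omega, hbl, ?_⟩
    exact isVertexIrreducible_of_minimal hb hsum hp hj hg0 hbl fun i h1 h2 =>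
      Nat.find_min' hex ⟨i, rfl, h1, h2⟩
  choose! g B hg0 hgD hB hirr using hedge
  let B' : Fin m → Fin (n + 1) := fun j => if j = q then p else B j
  have hB'inj : Function.Injective B' := by
    have hne : ∀ j, j ≠ q → b (B j) j ≠ 0 := fun j hj => by simp [hB j hj, hj, hg0 j hj]
    have hz : ∀ j j', j ≠ q → j' ≠ q → j' ≠ j → b (B j) j' = 0 := fun j j' hj hj' h => by
      simp [hB j hj, hj', h]
    intro x y hxy
    by_contra hne'
    by_cases hx : x = q
    · have hy : y ≠ q := fun h => hne' (hx.trans h.symm)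
      simp only [B', hx, hy, if_true, if_false] at hxy
      exact (hirr y hy).1 hxy.symm
    · by_cases hy : y = q
      · simp only [B', hx, hy, if_true, if_false] at hxy
        exact (hirr x hx).1 hxy
      · simp only [B', hx, hy, if_false] at hxy
        apply hne x hx
        rw [hxy]
        exact hz y x hy hx hne'
  have hall : ∀ l, IsVertexIrreducible b p q l → ∃ j, j ≠ q ∧ l = B j := by
    intro l hl
    by_contra! hcon
    have hnotin : l ∉ Finset.univ.image B' := by
      simp only [Finset.mem_image, Finset.mem_univ, true_and, not_exists]
      intro j hj
      by_cases hjq : j = q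
      · simp only [B', hjq, if_true] at hj
        exact hl.1 hj.symm
      · simp only [B', hjq, if_false] at hj
        exact hcon j hjq hj.symm
    -- A further irreducible row would give `m + 1` vanishing Jacobian columns, hence corank above
    -- `m`, against `hreg`.
    have hcard : (insert l (Finset.univ.image B')).card = m + 1 := by
      rw [Finset.card_insert_of_notMem hnotin, Finset.card_image_of_injective _ hB'inj]
      simp
    have hle := finrank_jacobianSpan_add_card_le (toricIdeal k b) (Pi.single p c)
      (insert l (Finset.univ.image B')) (by
        intro i hi f hf
        rw [Finset.mem_insert, Finset.mem_image] at hi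
        rcases hi with rfl | ⟨j, -, rfl⟩
        · exact eval_pderiv_of_isVertexIrreducible hD hsum hp c hl hf
        · by_cases hjq : j = q
          · simp only [B', hjq, if_true]
            exact eval_pderiv_vertex hb hD hsum hp c hf
          · simp only [B', hjq, if_false]
            exact eval_pderiv_of_isVertexIrreducible hD hsum hp c (hirr j hjq) hf)
    omega
  refine ⟨g j, hg0 j hj, hgD j hj, ⟨B j, hB j hj⟩, ?_⟩
  apply dvd_of_forall_isVertexIrreducible hb hsum hp hj
  intro l hl
  obtain ⟨j', hj', rfl⟩ := hall l hl
  by_cases h : j = j'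
  · subst h
    simp [hB j hj, hj]
  · simp [hB j' hj', hj, h]

end Vertex

/-! ### Sumsets -/

section Sumset

variable {d : ℕ}

@[simp]
theorem size_zero : size (0 : Fin d → ℕ) = 0 := by simp [size]

@[simp]
theorem size_add (x y : Fin d → ℕ) : size (x + y) = size x + size y := by
  simp [size, Finset.sum_add_distrib]

@[simp]
theorem size_smul (c : ℕ) (x : Fin d → ℕ) : size (c • x) = c * size x := by
  simp [size, Finset.mul_sum]

@[simp]
theorem size_single (i : Fin d) (c : ℕ) : size (Pi.single i c) = c := by
  simp [size]

theorem size_sum {ι : Type*} (s : Finset ι) (f : ι → Fin d → ℕ) :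
    size (∑ t ∈ s, f t) = ∑ t ∈ s, size (f t) := by
  simp only [size, Finset.sum_apply]
  exact Finset.sum_comm

theorem zero_mem_sumset_zero (A : Set (Fin d → ℕ)) : 0 ∈ sumset 0 A :=
  ⟨Fin.elim0, fun t => t.elim0, by simp⟩

theorem mem_sumset_one {A : Set (Fin d → ℕ)} {x : Fin d → ℕ} (hx : x ∈ A) : x ∈ sumset 1 A :=
  ⟨fun _ => x, fun _ => hx, by simp⟩

theorem add_mem_sumset {A : Set (Fin d → ℕ)} {s t : ℕ} {x y : Fin d → ℕ} (hx : x ∈ sumset s A)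
    (hy : y ∈ sumset t A) : x + y ∈ sumset (s + t) A := by
  obtain ⟨f, hf, rfl⟩ := hx
  obtain ⟨g, hg, rfl⟩ := hy
  refine ⟨Fin.append f g, fun i => ?_, ?_⟩
  · refine Fin.addCases (fun i => ?_) (fun i => ?_) i
    · simpa using hf i
    · simpa using hg i
  · simp [Fin.sum_univ_add]

theorem smul_mem_sumset {A : Set (Fin d → ℕ)} {x : Fin d → ℕ} (hx : x ∈ A) (c : ℕ) :
    c • x ∈ sumset c A :=
  ⟨fun _ => x, fun _ => hx, by simp⟩

theorem sum_smul_mem_sumset {A : Set (Fin d → ℕ)} {ι : Type*} (I : Finset ι) (c : ι → ℕ)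
    (x : ι → Fin d → ℕ) (hx : ∀ i, x i ∈ A) : ∑ i ∈ I, c i • x i ∈ sumset (∑ i ∈ I, c i) A := by
  classical
  induction I using Finset.induction_on with
  | empty => simpa using zero_mem_sumset_zero A
  | insert i I hi ih =>
    rw [Finset.sum_insert hi, Finset.sum_insert hi]
    exact add_mem_sumset (smul_mem_sumset (hx i) _) ih

theorem sumset_mono {A : Set (Fin d → ℕ)} (h0 : 0 ∈ A) {s t : ℕ} (h : s ≤ t) :
    sumset s A ⊆ sumset t A := by
  intro x hx
  obtain ⟨r, rfl⟩ := Nat.exists_eq_add_of_le h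
  simpa using add_mem_sumset hx (smul_mem_sumset h0 r)

theorem size_le_of_mem_sumset {A : Set (Fin d → ℕ)} {D s : ℕ} (hA : ∀ x ∈ A, size x ≤ D)
    {y : Fin d → ℕ} (hy : y ∈ sumset s A) : size y ≤ s * D := by
  obtain ⟨f, hf, rfl⟩ := hy
  rw [size_sum]
  calc ∑ t, size (f t) ≤ ∑ _t : Fin s, D := Finset.sum_le_sum fun t _ => hA _ (hf t)
    _ = s * D := by simp

theorem dvd_size_of_mem_sumset {A : Set (Fin d → ℕ)} {e s : ℕ} (hA : ∀ x ∈ A, e ∣ size x)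
    {y : Fin d → ℕ} (hy : y ∈ sumset s A) : e ∣ size y := by
  obtain ⟨f, hf, rfl⟩ := hy
  rw [size_sum]
  exact Finset.dvd_sum fun t _ => hA _ (hf t)

/-- A vector of `ℕ_e^d` with a large coordinate is a sum of the smallest number of elements of `A`
that its size allows. -/
theorem mem_sumset_of_large {A : Set (Fin d → ℕ)} {D e : ℕ} (hD : 0 < D) (he : 0 < e) (heD : e ∣ D)
    (h0 : 0 ∈ A) (hA : ∀ i j : Fin d, (Pi.single i (D - 1) + Pi.single j 1 : Fin d → ℕ) ∈ A)
    (hAe : ∀ i : Fin d, (Pi.single i (D - e) : Fin d → ℕ) ∈ A) {y : Fin d → ℕ} (hy : e ∣ size y)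
    {i : Fin d} (hi : D * D * d + D * D ≤ y i) {s : ℕ} (hs : size y ≤ s * D) :
    y ∈ sumset s A := by
  classical
  -- `q = ⌈|y| / D⌉` is the least number of summands. The deficit `q D - |y| = e r` is to be
  -- absorbed by `r` summands `(D - e) εᵢ`, all others having size `D`.
  obtain ⟨q, hq⟩ : ∃ q : ℕ, q = (size y + (D - 1)) / D := ⟨_, rfl⟩
  have hq1 : size y ≤ q * D := by
    have := Nat.div_add_mod (size y + (D - 1)) D
    have h2 := Nat.mod_lt (size y + (D - 1)) hD
    rw [← hq, mul_comm] at this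
    omega
  have hq2 : q * D ≤ size y + (D - 1) := by
    rw [hq]; exact Nat.div_mul_le_self _ _
  have hqs : q ≤ s := by
    rw [hq]
    apply Nat.le_of_lt_succ
    rw [Nat.div_lt_iff_lt_mul hD, Nat.succ_mul]
    omega
  obtain ⟨r, hr⟩ : e ∣ q * D - size y := Nat.dvd_sub (heD.mul_left q) hy
  have heD' : e ≤ D := Nat.le_of_dvd hD heD
  have hrD : r ≤ D := by
    have : r ≤ e * r := Nat.le_mul_of_pos_left _ he
    omega
  -- Off `i`, each `y j` splits into copies of `D εⱼ` and `z j` copies of `(D - 1) εᵢ + εⱼ`. The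
  -- latter consume coordinate `i`, which is why it must be large.
  let z : Fin d → ℕ := fun j => if j = i then 0 else y j % D
  let Z := ∑ j, z j
  have hZ : Z ≤ D * d := by
    calc Z ≤ ∑ _j : Fin d, D := Finset.sum_le_sum fun j _ => by
          simp only [z]
          split_ifs
          · exact Nat.zero_le _
          · exact (Nat.mod_lt _ hD).le
      _ = D * d := by simp [mul_comm]
  let Q := ∑ j ∈ Finset.univ.erase i, y j / D
  have hsz : size y = y i + (D * Q + Z) := by
    have h1 : Z = ∑ j ∈ Finset.univ.erase i, y j % D := by
      simp only [Z]
      rw [← Finset.add_sum_erase _ _ (Finset.mem_univ i)]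
      simp only [z, if_true, zero_add]
      exact Finset.sum_congr rfl fun j hj => if_neg (Finset.ne_of_mem_erase hj)
    rw [h1, size, ← Finset.add_sum_erase _ _ (Finset.mem_univ i), Finset.mul_sum,
      ← Finset.sum_add_distrib]
    simp_rw [Nat.div_add_mod]
  have hbig : (D - 1) * Z + r * (D - e) ≤ y i := by
    have h1 : (D - 1) * Z ≤ D * (D * d) := Nat.mul_le_mul (Nat.sub_le _ _) hZ
    have h2 : r * (D - e) ≤ D * D := Nat.mul_le_mul hrD (Nat.sub_le _ _)
    rw [← mul_assoc] at h1
    omega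
  have hDZ : (D - 1) * Z + Z = D * Z := by
    rw [← Nat.succ_mul]; congr 1; omega
  have hrDe : r * (D - e) + e * r = D * r := by
    rw [mul_comm r, ← Nat.add_mul]; congr 1; omega
  -- What remains of coordinate `i` is `D (q - Q - Z - r)`, so copies of `D εᵢ` finish the sum with
  -- exactly `q` terms.
  have hyi : y i + D * (Q + Z + r) = D * q + ((D - 1) * Z + r * (D - e)) := by
    rw [mul_add, mul_add]
    rw [mul_comm q D] at hq1 hr
    omega
  have hle : Q + Z + r ≤ q := by
    have : D * (Q + Z + r) ≤ D * q := by omega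
    exact Nat.le_of_mul_le_mul_left this hD
  obtain ⟨p, hp⟩ := Nat.exists_eq_add_of_le hle
  have hyi' : y i = D * p + ((D - 1) * Z + r * (D - e)) := by
    rw [hp, mul_add D (Q + Z + r)] at hyi
    omega
  let c : Fin d → ℕ := fun j => if j = i then p else y j / D
  have hc : ∑ j, c j = p + Q := by
    rw [← Finset.add_sum_erase _ _ (Finset.mem_univ i)]
    simp only [c, if_true]
    congr 1
    exact Finset.sum_congr rfl fun j hj => if_neg (Finset.ne_of_mem_erase hj)
  have hmem : ∑ j, c j • (Pi.single j (D - 1) + Pi.single j 1 : Fin d → ℕ) +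
      ∑ j, z j • (Pi.single i (D - 1) + Pi.single j 1 : Fin d → ℕ) +
      r • (Pi.single i (D - e) : Fin d → ℕ) ∈ sumset (∑ j, c j + ∑ j, z j + r) A :=
    add_mem_sumset (add_mem_sumset (sum_smul_mem_sumset _ _ _ fun j => hA j j)
      (sum_smul_mem_sumset _ _ _ fun j => hA i j)) (smul_mem_sumset (hAe i) r)
  have hcount : ∑ j, c j + ∑ j, z j + r = q := by
    rw [hc, hp]; simp only [Z]; omega
  rw [hcount] at hmem
  refine sumset_mono h0 hqs ?_
  convert hmem using 1
  ext j
  have hD1 : D - 1 + 1 = D := by omega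
  have e1 : (∑ x, c x • (Pi.single x (D - 1) + Pi.single x 1 : Fin d → ℕ)) j = c j * D := by
    rw [Finset.sum_apply, Finset.sum_eq_single j]
    · simp [hD1]
    · intro x _ hx
      simp [hx.symm]
    · simp
  have e2 : (∑ x, z x • (Pi.single i (D - 1) + Pi.single x 1 : Fin d → ℕ)) j =
      Z * (Pi.single i (D - 1) : Fin d → ℕ) j + z j := by
    simp only [Finset.sum_apply, Pi.smul_apply, Pi.add_apply, smul_eq_mul, mul_add,
      Finset.sum_add_distrib, ← Finset.sum_mul]
    congr 1
    rw [Finset.sum_eq_single j]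
    · simp
    · intro x _ hx
      simp [hx.symm]
    · simp
  rw [Pi.add_apply, Pi.add_apply, e1, e2]
  by_cases hj : j = i
  · subst hj
    simp only [c, z, if_true, Pi.single_eq_same, Pi.smul_apply, smul_eq_mul]
    rw [hyi', mul_comm D p, mul_comm Z]
    omega
  · have := Nat.div_add_mod (y j) D
    rw [mul_comm] at this
    simp [c, z, hj, this]

end Sumset

/-! ### The combinatorial equivalences -/

section Shape

variable {d n D : ℕ} {a : Fin (n + 1) → Fin d → ℕ} {e : ℕ}

/-- Here `H` consists of the lattice vectors in no sumset. It lies in the box of small coordinates,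
and since the sumsets increase, one `s₀` serves all reachable vectors of the box. -/
theorem AffineShape.sumsetStructure (hD : 0 < D) (hsize : ∀ i, size (a i) ≤ D)
    (h : AffineShape D a e) : SumsetStructure D a e := by
  obtain ⟨he, -, heD, h0, hA, hAe, hdvd, hsing⟩ := h
  set A := Set.range a
  set K := D * D * d + D * D
  have hbox : {y : Fin d → ℕ | ∀ i, y i < K}.Finite :=
    (Set.finite_Iic (fun _ => K : Fin d → ℕ)).subset fun y hy i => (hy i).le
  have hlarge : ∀ y, e ∣ size y → y ∉ {y : Fin d → ℕ | ∀ i, y i < K} → ∀ s, size y ≤ s * D →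
      y ∈ sumset s A := by
    intro y hy hK s hs
    simp only [Set.mem_ofPred_eq, not_forall, not_lt] at hK
    obtain ⟨i, hi⟩ := hK
    exact mem_sumset_of_large hD he heD h0 hA hAe hy hi hs
  refine ⟨he, {y | e ∣ size y ∧ ∀ s, y ∉ sumset s A}, ?_, fun y hy => hy.1, ?_, ?_⟩
  · refine hbox.subset fun y hy => ?_
    by_contra hK
    exact hy.2 (size y) (hlarge y hy.1 hK _ (Nat.le_mul_of_pos_right _ hD))
  · intro he1
    obtain ⟨j, hj⟩ := hsing he1
    -- A sum equal to `εⱼ` must have `εⱼ` itself as a summand.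
    refine ⟨Pi.single j 1, by simp [he1], ?_⟩
    rintro s ⟨f, hf, hs⟩
    have hsz := congrArg size hs
    rw [size_sum, size_single] at hsz
    have hex : ∃ t, size (f t) ≠ 0 := by
      by_contra! hcon
      simp [hcon] at hsz
    obtain ⟨t, ht⟩ := hex
    have hle : f t ≤ Pi.single j 1 := by
      rw [hs]
      exact Finset.single_le_sum (f := f) (fun _ _ => zero_le) (Finset.mem_univ t)
    apply hj
    convert hf t
    refine le_antisymm (fun j' => ?_) hle
    by_cases hjj : j' = j
    · subst hjj
      rw [Pi.single_eq_same]
      by_contra h1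
      apply ht
      refine Finset.sum_eq_zero fun x _ => ?_
      by_cases hx : x = j'
      · subst hx
        change ¬1 ≤ f t x at h1
        omega
      · simpa [hx] using hle x
    · simp [hjj]
  · have hev : ∀ᶠ s in Filter.atTop, ∀ y ∈ {y : Fin d → ℕ | ∀ i, y i < K},
        (∃ t, y ∈ sumset t A) → y ∈ sumset s A := by
      rw [Filter.eventually_all_finite hbox]
      intro y _
      by_cases hex : ∃ t, y ∈ sumset t A
      · obtain ⟨t, ht⟩ := hex
        filter_upwards [Filter.eventually_ge_atTop t] with s hs _
        exact sumset_mono h0 hs ht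
      · exact Filter.Eventually.of_forall fun s h => absurd h hex
    obtain ⟨s₀, hs₀⟩ := Filter.eventually_atTop.mp hev
    refine ⟨s₀, fun s hs => Set.Subset.antisymm (fun y hy => ?_) fun y hy => ?_⟩
    · exact ⟨⟨dvd_size_of_mem_sumset (by rintro _ ⟨i, rfl⟩; exact hdvd i) hy,
        size_le_of_mem_sumset (by rintro _ ⟨i, rfl⟩; exact hsize i) hy⟩, fun h => h.2 s hy⟩
    · obtain ⟨⟨hye, hys⟩, hyH⟩ := hy
      by_cases hK : y ∈ {y : Fin d → ℕ | ∀ i, y i < K}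
      · apply hs₀ s hs y hK
        by_contra! hcon
        exact hyH ⟨hye, hcon⟩
      · exact hlarge y hye hK s hys

/-- Translating by large multiples of `D εᵢ` leaves any finite exceptional set. -/
theorem exists_add_smul_mem_sumset (hD : 0 < D) {H : Set (Fin d → ℕ)} (hH : H.Finite) {s₀ : ℕ}
    (hs : ∀ s, s₀ ≤ s → sumset s (Set.range a) = simplexMod d D s e \ H) (heD : e ∣ D)
    {z : Fin d → ℕ} (hze : e ∣ size z) (hzD : size z ≤ D) (i : Fin d) :
    ∃ s, z + s • Pi.single i D ∈ sumset (s + 1) (Set.range a) := by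
  have hinj : Function.Injective fun s : ℕ => z + s • (Pi.single i D : Fin d → ℕ) := by
    intro s t hst
    have := congrFun hst i
    simp only [Pi.add_apply, Pi.smul_apply, Pi.single_eq_same, smul_eq_mul] at this
    exact Nat.eq_of_mul_eq_mul_right hD (Nat.add_left_cancel this)
  have hfin := hH.preimage hinj.injOn
  -- Only finitely many translates meet `H`, so some `s ≥ s₀` avoids it.
  obtain ⟨s, hsH, hss⟩ := (hfin.infinite_compl.sdiff (Set.finite_Iio s₀)).nonempty
  refine ⟨s, ?_⟩
  rw [hs (s + 1) (by simp at hss; omega)]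
  refine ⟨⟨?_, ?_⟩, hsH⟩
  · change e ∣ size _
    rw [size_add, size_smul, size_single]
    exact dvd_add hze (heD.mul_left s)
  · simp only [size_add, size_smul, size_single]
    linarith

/-- Decompose `z + s D εᵢ` into `s + 1` elements. If `|z| = D`, all summands have size `D`, and for
`z = (D - 1) εᵢ + εⱼ` with `j ≠ i` the one involving `εⱼ` is `z`. If `z = (D - e) εᵢ`, the total
deficit is `e`; divisibility by `e` concentrates it in one summand, which is `z`. When `e = 1`,
having all `εⱼ` in `A` would make every vector reachable and `H` empty. -/
theorem SumsetStructure.affineShape (hd : 1 ≤ d) (hD : 2 ≤ D) (ha0 : a 0 = 0)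
    (haD : ∀ j : Fin d, (Pi.single j D : Fin d → ℕ) ∈ Set.range a) (hsize : ∀ i, size (a i) ≤ D)
    (h : SumsetStructure D a e) : AffineShape D a e := by
  obtain ⟨he, H, hH, -, hne, s₀, hs⟩ := h
  have h0 : (0 : Fin d → ℕ) ∈ Set.range a := ⟨0, ha0⟩
  have hsub : ∀ s, s₀ ≤ s → ∀ y ∈ sumset s (Set.range a), e ∣ size y := by
    intro s h1 y hy
    rw [hs s h1] at hy
    exact hy.1.1
  have hs₀ : e ∣ s₀ * D := by
    have := hsub s₀ le_rfl _ (smul_mem_sumset (haD ⟨0, hd⟩) s₀)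
    rwa [size_smul, size_single] at this
  have hdvd : ∀ i, e ∣ size (a i) := by
    intro i
    have := hsub (s₀ + 1) (by omega) _
      (add_mem_sumset (smul_mem_sumset (haD ⟨0, hd⟩) s₀) (mem_sumset_one ⟨i, rfl⟩))
    simp only [size_add, size_smul, size_single] at this
    exact (Nat.dvd_add_right hs₀).mp this
  have heD : e ∣ D := by
    obtain ⟨i, hi⟩ := haD ⟨0, hd⟩
    have := hdvd i
    rwa [hi, size_single] at this
  have heD' : e ≤ D := Nat.le_of_dvd (by omega) heD
  refine ⟨he, heD', heD, h0, fun i j => ?_, fun i => ?_, hdvd, fun he1 => ?_⟩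
  · by_cases hij : i = j
    · subst hij
      rw [← Pi.single_add, Nat.sub_add_cancel (by omega)]
      exact haD i
    have hsz : size (Pi.single i (D - 1) + Pi.single j 1 : Fin d → ℕ) = D := by
      simp only [size_add, size_single]; omega
    obtain ⟨s, f, hf, hfs⟩ := exists_add_smul_mem_sumset (by omega) hH hs heD
      (by rw [hsz]; exact heD) hsz.le i
    have hfD : ∀ t, size (f t) ≤ D := fun t => by
      obtain ⟨l, hl⟩ := hf t
      rw [← hl]; exact hsize l
    have hsum := congrArg size hfs
    rw [size_sum, size_add, size_smul, hsz, size_single] at hsum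
    have hfD' : ∀ t, size (f t) = D := by
      have : ∑ t, size (f t) = ∑ _t : Fin (s + 1), D := by
        rw [← hsum]; simp; ring
      intro t
      exact (Finset.sum_eq_sum_iff_of_le fun t _ => hfD t).mp this t (Finset.mem_univ t)
    have hcol : ∀ x, ∑ t, f t x = (Pi.single i (D - 1) + Pi.single j 1 + s • Pi.single i D :
        Fin d → ℕ) x := by
      intro x
      rw [hfs, Finset.sum_apply]
    have hj : ∑ t, f t j = 1 := by
      rw [hcol j]; simp [Ne.symm hij]
    have hex : ∃ t, f t j ≠ 0 := by
      by_contra! hcon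
      simp [hcon] at hj
    obtain ⟨t, ht⟩ := hex
    have hle : ∀ x, f t x ≤ ∑ t, f t x := fun x =>
      Finset.single_le_sum (f := fun t => f t x) (fun _ _ => Nat.zero_le _) (Finset.mem_univ t)
    have htj : f t j = 1 := by have := hle j; omega
    have hx0 : ∀ x, x ≠ i → x ≠ j → f t x = 0 := by
      intro x hxi hxj
      have := hle x
      rw [hcol x] at this
      simpa [hxi, hxj] using this
    have hti : f t i + 1 = D := by
      rw [← hfD' t, size, ← Finset.add_sum_erase _ _ (Finset.mem_univ i),
        Finset.sum_eq_single j, htj]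
      · intro x hx hxj
        exact hx0 x (Finset.ne_of_mem_erase hx) hxj
      · simp [Ne.symm hij]
    convert hf t using 1
    ext x
    by_cases hxi : x = i
    · subst hxi
      simp [hij]; omega
    · by_cases hxj : x = j
      · subst hxj; simp [hxi, htj]
      · simp [hxi, hxj, hx0 x hxi hxj]
  · obtain ⟨s, f, hf, hfs⟩ := exists_add_smul_mem_sumset (by omega) hH hs heD
      (z := Pi.single i (D - e)) (by rw [size_single]; exact Nat.dvd_sub heD dvd_rfl)
      (by rw [size_single]; omega) i
    have hfD : ∀ t, size (f t) ≤ D := fun t => by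
      obtain ⟨l, hl⟩ := hf t
      rw [← hl]; exact hsize l
    have hsum := congrArg size hfs
    rw [size_sum, size_add, size_smul, size_single, size_single] at hsum
    have hex : ∃ t, size (f t) < D := by
      by_contra! hcon
      have : ∑ _t : Fin (s + 1), D ≤ ∑ t, size (f t) := Finset.sum_le_sum fun t _ => hcon t
      simp only [Finset.sum_const, Finset.card_univ, Fintype.card_fin, smul_eq_mul,
        Nat.succ_mul] at this
      omega
    obtain ⟨t, ht⟩ := hex
    have hx0 : ∀ x, x ≠ i → f t x = 0 := by
      intro x hxi
      have h1 := Finset.single_le_sum (f := fun t => f t x) (fun _ _ => Nat.zero_le _)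
        (Finset.mem_univ t)
      rw [← Finset.sum_apply, ← hfs] at h1
      simpa [hxi] using h1
    have hft : size (f t) = f t i := by
      rw [size, Finset.sum_eq_single i]
      · intro x _ hx
        exact hx0 x hx
      · simp
    have hge : D - e ≤ size (f t) := by
      have h1 : ∑ t' ∈ Finset.univ.erase t, size (f t') ≤ ∑ _t' ∈ Finset.univ.erase t, D :=
        Finset.sum_le_sum fun t' _ => hfD t'
      rw [Finset.sum_const, Finset.card_erase_of_mem (Finset.mem_univ t), Finset.card_univ,
        Fintype.card_fin, Nat.add_sub_cancel, smul_eq_mul] at h1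
      rw [← Finset.add_sum_erase _ _ (Finset.mem_univ t)] at hsum
      omega
    have hle : size (f t) ≤ D - e := by
      have h1 : e ∣ size (f t) := by
        obtain ⟨l, hl⟩ := hf t
        rw [← hl]; exact hdvd l
      have h2 := Nat.le_of_dvd (by omega) (Nat.dvd_sub heD h1)
      omega
    convert hf t using 1
    ext x
    by_cases hxi : x = i
    · subst hxi
      simp; omega
    · simp [hxi, hx0 x hxi]
  · by_contra! hcon
    obtain ⟨y, hy⟩ := hne he1
    have h1 : y ∈ sumset (size y) (Set.range a) := by
      have := sum_smul_mem_sumset Finset.univ y (fun j => Pi.single j 1) hcon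
      convert! this
      ext x
      rw [Finset.sum_apply, Finset.sum_eq_single x]
      · simp
      · intro j _ hj
        simp [Ne.symm hj]
      · simp
    have h2 := sumset_mono h0 (le_max_left (size y) s₀) h1
    rw [hs _ (le_max_right _ _)] at h2
    exact h2.2 hy

/-! ### Homogenization -/

theorem homogenization_apply_succ (i : Fin (n + 1)) (j : Fin d) :
    homogenization D a i j.succ = a i j := rfl

theorem homogenization_apply_zero (i : Fin (n + 1)) :
    homogenization D a i 0 = D - size (a i) := rfl

theorem sum_homogenization (hsize : ∀ i, size (a i) ≤ D) (i : Fin (n + 1)) :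
    ∑ j, homogenization D a i j = D := by
  rw [Fin.sum_univ_succ]
  simp only [homogenization_apply_succ, homogenization_apply_zero]
  exact Nat.sub_add_cancel (hsize i)

theorem homogenization_injective (ha : Function.Injective a) :
    Function.Injective (homogenization D a) := fun _ _ h =>
  ha (funext fun j => congrFun h j.succ)

/-- Coordinate 0 is determined by the others through the total `D`. -/
theorem mem_range_homogenization_iff {w : Fin (d + 1) → ℕ} {y : Fin d → ℕ}
    (hw : w 0 + size y = D) (hy : ∀ j : Fin d, w j.succ = y j) :
    w ∈ Set.range (homogenization D a) ↔ y ∈ Set.range a := by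
  constructor
  · rintro ⟨i, rfl⟩
    exact ⟨i, funext fun j => hy j⟩
  · rintro ⟨i, rfl⟩
    refine ⟨i, funext fun j => ?_⟩
    refine Fin.cases ?_ (fun j => (hy j).symm) j
    rw [homogenization_apply_zero]; omega

theorem single_mem_range_homogenization (ha0 : a 0 = 0)
    (haD : ∀ j : Fin d, (Pi.single j D : Fin d → ℕ) ∈ Set.range a) (j : Fin (d + 1)) :
    Pi.single j D ∈ Set.range (homogenization D a) := by
  refine Fin.cases ?_ (fun j => ?_) j
  · rw [mem_range_homogenization_iff (y := 0) (by simp) (by simp)]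
    exact ⟨0, ha0⟩
  · rw [mem_range_homogenization_iff (y := Pi.single j D) (by simp)
      (by intro x; simp [Pi.single_apply, Fin.succ_inj])]
    exact haD j

theorem homogenizedShape_iff_affineShape (hD : 2 ≤ D) (ha0 : a 0 = 0)
    (hsize : ∀ i, size (a i) ≤ D) : HomogenizedShape D a e ↔ AffineShape D a e := by
  unfold HomogenizedShape AffineShape
  refine and_congr_right fun he => and_congr_right fun heD => and_congr_right fun hdvd => ?_
  have h0 : (0 : Fin d → ℕ) ∈ Set.range a := ⟨0, ha0⟩
  have h1 : ∀ i j : Fin d, (Pi.single i.succ (D - 1) + Pi.single j.succ 1 : Fin (d + 1) → ℕ) ∈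
      Set.range (homogenization D a) ↔ (Pi.single i (D - 1) + Pi.single j 1 : Fin d → ℕ) ∈
      Set.range a := fun i j => mem_range_homogenization_iff (by simp; omega)
        (by intro x; simp [Pi.single_apply, Fin.succ_inj])
  have h2 : ∀ j : Fin d, (Pi.single 0 e + Pi.single j.succ (D - e) : Fin (d + 1) → ℕ) ∈
      Set.range (homogenization D a) ↔ (Pi.single j (D - e) : Fin d → ℕ) ∈ Set.range a :=
    fun j => mem_range_homogenization_iff (by simp; omega)
        (by intro x; simp [Pi.single_apply, Fin.succ_inj])
  have h3 : ∀ j : Fin d, (Pi.single 0 (D - 1) + Pi.single j.succ 1 : Fin (d + 1) → ℕ) ∈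
      Set.range (homogenization D a) ↔ (Pi.single j 1 : Fin d → ℕ) ∈ Set.range a :=
    fun j => mem_range_homogenization_iff (by simp; omega)
        (by intro x; simp [Pi.single_apply, Fin.succ_inj])
  have h4 : ∀ i, e ∣ homogenization D a i 0 ↔ e ∣ size (a i) := fun i => by
    rw [homogenization_apply_zero]
    exact Nat.dvd_sub_iff_right (hsize i) hdvd
  simp only [h1, h2, h3, h4, h0, true_and]

end Shape

/-! ### Singular points -/

section Singular

variable {k : Type*} [Field k] {n m : ℕ} {b : Fin (n + 1) → Fin m → ℕ} {D : ℕ}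

/-- If the local semigroup at a vertex is free on the edges, then the toric variety is smooth on the
chart of that vertex. -/
theorem le_finrank_jacobianSpan_of_edges (hsum : ∀ i, ∑ j, b i j = D) {p : Fin (n + 1)} {q : Fin m}
    (hp : b p = Pi.single q D) {v : Fin (n + 1) → k} (hv : v p ≠ 0) (g : Fin m → ℕ)
    (hgD : ∀ j, j ≠ q → g j ≤ D)
    (hedge : ∀ j, j ≠ q → (Pi.single q (D - g j) + Pi.single j (g j) : Fin m → ℕ) ∈ Set.range b)
    (hdvd : ∀ j, j ≠ q → ∀ l, g j ∣ b l j) :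
    n + 1 ≤ Module.finrank k (jacobianSpan (toricIdeal k b) v) + m := by
  classical
  choose! B hB using hedge
  let B' : Fin m → Fin (n + 1) := fun j => if j = q then p else B j
  have hBq : B' q = p := if_pos rfl
  have hBj : ∀ j, j ≠ q → B' j = B j := fun j hj => if_neg hj
  refine le_finrank_jacobianSpan_add v B' q (by rwa [hBq]) fun l => ?_
  -- `N` counts the edge vectors needed for row `l`; the single copy of `b p` on the right balances
  -- the degrees `1 + N`.
  refine ⟨∑ j ∈ Finset.univ.erase q, b l j / g j, fun j => if j = q then 1 else b l j / g j, ?_⟩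
  intro j
  have hmul : ∀ j, j ≠ q → b l j / g j * g j = b l j := fun j hj => Nat.div_mul_cancel (hdvd j hj l)
  rw [← Finset.add_sum_erase _ _ (Finset.mem_univ q)]
  simp only [if_true, hBq, one_mul]
  have hrest : ∑ t ∈ Finset.univ.erase q, (if t = q then 1 else b l t / g t) * b (B' t) j =
      ∑ t ∈ Finset.univ.erase q, b l t / g t * (Pi.single q (D - g t) + Pi.single t (g t) :
        Fin m → ℕ) j := by
    refine Finset.sum_congr rfl fun t ht => ?_
    have ht' := Finset.ne_of_mem_erase ht
    rw [if_neg ht', hBj t ht', hB t ht']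
  rw [hrest, hp]
  by_cases hj : j = q
  · subst hj
    have h1 : ∑ t ∈ Finset.univ.erase j, b l t / g t *
        (Pi.single j (D - g t) + Pi.single t (g t) : Fin m → ℕ) j +
        ∑ t ∈ Finset.univ.erase j, b l t = (∑ t ∈ Finset.univ.erase j, b l t / g t) * D := by
      rw [← Finset.sum_add_distrib, Finset.sum_mul]
      refine Finset.sum_congr rfl fun t ht => ?_
      have ht' := Finset.ne_of_mem_erase ht
      rw [Pi.add_apply, Pi.single_eq_same, Pi.single_eq_of_ne ht'.symm, add_zero]
      nth_rewrite 2 [← hmul t ht']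
      rw [← mul_add, Nat.sub_add_cancel (hgD t ht')]
    have h2 := hsum l
    rw [← Finset.add_sum_erase _ _ (Finset.mem_univ j)] at h2
    rw [Pi.single_eq_same]
    omega
  · rw [Pi.single_eq_of_ne hj, mul_zero, add_zero, zero_add, Finset.sum_eq_single j]
    · simp [hj, hmul j hj]
    · intro t _ htj
      simp [hj, htj.symm]
    · simp [hj]

theorem exists_edge_of_not_isSingularPoint [IsAlgClosed k] (hb : Function.Injective b) (hD : D ≠ 0)
    (hsum : ∀ i, ∑ j, b i j = D) (hvert : ∀ j, Pi.single j D ∈ Set.range b)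
    {p : Fin (n + 1)} {q : Fin m} (hp : b p = Pi.single q D)
    {hne : (Pi.single p 1 : Fin (n + 1) → k) ≠ 0}
    (hreg : ¬IsSingularPoint (toricVariety k b) (Projectivization.mk k (Pi.single p 1) hne))
    (j : Fin m) (hj : j ≠ q) :
    ∃ g, g ≠ 0 ∧ g ≤ D ∧ (Pi.single q (D - g) + Pi.single j g : Fin m → ℕ) ∈ Set.range b ∧
      ∀ l, g ∣ b l j := by
  rw [isSingularPoint_toricVariety_iff hD hsum hvert, not_and, not_lt] at hreg
  have h := hreg (mk_mem_toricVariety hD hsum hne (single_mem_zeroLocus_toricIdeal hb hsum hp))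
  -- The chosen representative is only a unit multiple of the basis vector, hence the free scalar
  -- `c` in the vertex lemmas.
  obtain ⟨c, hc⟩ := Projectivization.exists_smul_eq_mk_rep k _ hne
  rw [← hc, Units.smul_def, ← Pi.single_smul, smul_eq_mul, mul_one] at h
  exact exists_edge_of_le_finrank hb hD hsum hvert hp _ h j hj

/-- A point of the affine cone at which the coordinates of all vertices but one vanish has only one
nonzero coordinate. -/
theorem eq_zero_of_vertices_eq_zero (hb : Function.Injective b)
    (hsum : ∀ i, ∑ j, b i j = D) (hvert : ∀ j, Pi.single j D ∈ Set.range b) {p : Fin (n + 1)}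
    {q : Fin m} (hp : b p = Pi.single q D) {v : Fin (n + 1) → k}
    (hv : v ∈ zeroLocus k (toricIdeal k b))
    (h0 : ∀ j, j ≠ q → ∀ i, b i = Pi.single j D → v i = 0) {l : Fin (n + 1)} (hl : l ≠ p) :
    v l = 0 := by
  classical
  choose P hP using hvert
  obtain ⟨j, hj, hlj⟩ : ∃ j, j ≠ q ∧ b l j ≠ 0 := by
    by_contra! hcon
    exact hl (eq_of_forall_ne_eq hb hsum (q := q) fun j hj => by rw [hcon j hj]; simp [hp, hj])
  -- On the cone, `x_l ^ D` is a product of vertex coordinates, one of which vanishes here.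
  have hmem : monomial (Finsupp.single l D) 1 - monomial (∑ j, Finsupp.single (P j) (b l j)) 1 ∈
      toricIdeal k b := by
    apply monomial_sub_monomial_mem_toricIdeal
    intro x
    simp only [Finsupp.finsetSum_apply, Finsupp.single_apply, Finset.sum_mul, ite_mul, zero_mul]
    rw [Finset.sum_comm]
    simp only [Finset.sum_ite_eq, Finset.mem_univ, if_true, hP]
    rw [Finset.sum_eq_single x]
    · simp [mul_comm]
    · intro y _ hy
      simp [hy.symm]
    · simp
  have h := hv _ hmem
  rw [map_sub, aeval_monomial, aeval_monomial, map_one, one_mul, one_mul,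
    Finsupp.prod_single_index (by simp), Finsupp.prod_fintype _ _ (by simp),
    Finset.prod_eq_zero (Finset.mem_univ (P j)), sub_zero] at h
  · exact eq_zero_of_pow_eq_zero h
  · rw [h0 j hj _ (hP j), zero_pow]
    rw [Finsupp.finsetSum_apply]
    intro hz
    have := Finset.sum_eq_zero_iff.mp hz j (Finset.mem_univ j)
    simp [hlj] at this

end Singular

/-! ### The single singular point and the shape of the homogenization -/

section Main

variable {k : Type*} [Field k] [IsAlgClosed k] {n d D : ℕ} {a : Fin (n + 1) → Fin d → ℕ}

theorem homogenization_zero (ha0 : a 0 = 0) : homogenization D a 0 = Pi.single 0 D := by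
  ext j
  refine Fin.cases ?_ (fun j => ?_) j
  · simp [homogenization_apply_zero, ha0]
  · simp [homogenization_apply_succ, ha0]

theorem SingleSingularPoint.exists_homogenizedShape (hd : 1 ≤ d) (hD : 2 ≤ D)
    (ha : Function.Injective a) (ha0 : a 0 = 0)
    (haD : ∀ j : Fin d, (Pi.single j D : Fin d → ℕ) ∈ Set.range a) (hsize : ∀ i, size (a i) ≤ D)
    (hgcd : ∀ g : ℕ, (∀ i j, g ∣ a i j) → g = 1) (h : SingleSingularPoint k D a) :
    ∃ e, HomogenizedShape D a e := by
  classical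
  have hb := homogenization_injective (D := D) ha
  have hsum := sum_homogenization hsize
  have hvert := single_mem_range_homogenization ha0 haD
  have hb0 := homogenization_zero (D := D) ha0
  set b := homogenization D a
  have hD0 : D ≠ 0 := by omega
  have hsing : ∀ P, IsSingularPoint (toricVariety k b) P ↔ P = firstPoint k n := fun P =>
    Set.ext_iff.mp h P
  have hedge : ∀ (i : Fin d) (j : Fin (d + 1)), j ≠ i.succ → ∃ g, g ≠ 0 ∧ g ≤ D ∧
      (Pi.single i.succ (D - g) + Pi.single j g : Fin (d + 1) → ℕ) ∈ Set.range b ∧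
      ∀ l, g ∣ b l j := by
    intro i
    obtain ⟨p, hp⟩ := hvert i.succ
    have hp0 : p ≠ 0 := by
      rintro rfl
      have := congrFun (hp.symm.trans hb0) 0
      simp at this
      omega
    have hne : (Pi.single p 1 : Fin (n + 1) → k) ≠ 0 := by simp
    refine exists_edge_of_not_isSingularPoint (hne := hne) hb hD0 hsum hvert hp ?_
    rw [hsing, firstPoint, Projectivization.mk_eq_mk_iff']
    rintro ⟨c, hc⟩
    have := congrFun hc p
    simp [hp0] at this
  choose! g hg0 hgD hg hgdvd using hedge
  let i₀ : Fin d := ⟨0, hd⟩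
  have hne0 : ∀ i : Fin d, (0 : Fin (d + 1)) ≠ i.succ := fun i => (Fin.succ_ne_zero i).symm
  -- Every step towards vertex 0 divides column 0, in which the other such steps occur as entries;
  -- so they all agree, and the common value is `e`.
  have hswap : ∀ i i' : Fin d, g i 0 ∣ g i' 0 := by
    intro i i'
    obtain ⟨l, hl⟩ := hg i' 0 (hne0 i')
    have := hgdvd i 0 (hne0 i) l
    rw [hl] at this
    simpa [(hne0 i')] using this
  have hconst : ∀ i, g i 0 = g i₀ 0 := fun i => Nat.dvd_antisymm (hswap _ _) (hswap _ _)
  -- This step divides all of column `j`, in particular `D` and `D - g j j'.succ`. Hence it divides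
  -- `g j j'.succ`, and with it column `j'`, so the gcd condition makes it 1.
  have hone : ∀ i j : Fin d, i ≠ j → g i j.succ = 1 := by
    intro i j hij
    have hsucc : ∀ {x y : Fin d}, x ≠ y → y.succ ≠ x.succ := fun hxy h' =>
      hxy (Fin.succ_injective _ h').symm
    apply hgcd
    intro l j'
    by_cases hjj : j' = j
    · subst hjj
      exact hgdvd i _ (hsucc hij) l
    have h1 : g i j.succ ∣ D := by
      obtain ⟨p, hp⟩ := hvert j.succ
      have := hgdvd i _ (hsucc hij) p
      rw [hp] at this
      simpa using this
    have h2 : g i j.succ ∣ D - g j j'.succ := by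
      obtain ⟨p, hp⟩ := hg j j'.succ (hsucc (Ne.symm hjj))
      have := hgdvd i _ (hsucc hij) p
      rw [hp] at this
      simpa [hjj, Ne.symm hjj] using this
    have h3 : g i j.succ ∣ g j j'.succ :=
      (Nat.dvd_sub_iff_right (hgD j _ (hsucc (Ne.symm hjj))) h1).mp h2
    exact h3.trans (hgdvd j _ (hsucc (Ne.symm hjj)) l)
  refine ⟨g i₀ 0, Nat.pos_of_ne_zero (hg0 _ _ (hne0 _)), hgD _ _ (hne0 _), ?_, fun i j => ?_,
    fun j => ?_, hgdvd _ _ (hne0 _), fun he1 => ?_⟩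
  · have := hgdvd i₀ 0 (hne0 _) 0
    rw [hb0] at this
    simpa using this
  · by_cases hij : i = j
    · subst hij
      rw [← Pi.single_add, Nat.sub_add_cancel (by omega)]
      exact hvert _
    · have := hg i j.succ (fun h' => hij (Fin.succ_injective _ h').symm)
      rwa [hone i j hij] at this
  · have := hg j 0 (hne0 j)
    rwa [hconst, add_comm (Pi.single _ _)] at this
  · by_contra! hcon
    have hs := (hsing (firstPoint k n)).mpr rfl
    rw [isSingularPoint_toricVariety_iff hD0 hsum hvert] at hs
    refine absurd hs.2 (not_lt.mpr ?_)
    refine le_finrank_jacobianSpan_of_edges hsum hb0 ?_ (fun _ => 1) (fun _ _ => by omega) ?_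
      (fun _ _ _ => one_dvd _)
    · obtain ⟨c, hc⟩ := Projectivization.exists_smul_eq_mk_rep k
        (Pi.single 0 1 : Fin (n + 1) → k) (by simp)
      rw [firstPoint, ← hc, Units.smul_def]
      simp
    · intro j hj
      obtain ⟨j', rfl⟩ := Fin.exists_succ_eq.mpr hj
      exact hcon j'

theorem HomogenizedShape.singleSingularPoint (hD : 2 ≤ D)
    (ha : Function.Injective a) (ha0 : a 0 = 0)
    (haD : ∀ j : Fin d, (Pi.single j D : Fin d → ℕ) ∈ Set.range a) (hsize : ∀ i, size (a i) ≤ D)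
    (hgcd : ∀ g : ℕ, (∀ i j, g ∣ a i j) → g = 1) {e : ℕ} (h : HomogenizedShape D a e) :
    SingleSingularPoint k D a := by
  classical
  have hb := homogenization_injective (D := D) ha
  have hsum := sum_homogenization hsize
  have hvert := single_mem_range_homogenization ha0 haD
  have hb0 := homogenization_zero (D := D) ha0
  obtain ⟨he, heD, hdvd, hA, hAe, hdvdall, hlast⟩ := h
  unfold SingleSingularPoint
  set b := homogenization D a
  have hD0 : D ≠ 0 := by omega
  refine Set.Subset.antisymm (fun P hP => ?_) ?_
  · rw [Set.mem_singleton_iff]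
    by_contra hne
    have hP' := (isSingularPoint_toricVariety_iff hD0 hsum hvert P).mp hP
    have hv := (mem_toricVariety_iff hD0 hsum).mp hP'.1
    -- A point other than `(1:0:⋯:0)` lies in the chart of a vertex `j ≠ 0`, where the shape gives
    -- free edges of steps `e` and 1.
    obtain ⟨j, hj, p, hp, hvp⟩ : ∃ j, j ≠ 0 ∧ ∃ p, b p = Pi.single j D ∧ P.rep p ≠ 0 := by
      by_contra! hcon
      apply hne
      rw [← P.mk_rep, firstPoint, Projectivization.mk_eq_mk_iff']
      refine ⟨P.rep 0, ?_⟩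
      ext l
      by_cases hl : l = 0
      · simp [hl]
      · rw [eq_zero_of_vertices_eq_zero hb hsum hvert hb0 hv hcon hl]
        simp [hl]
    obtain ⟨i, rfl⟩ := Fin.exists_succ_eq.mpr hj
    refine absurd hP'.2 (not_lt.mpr ?_)
    refine le_finrank_jacobianSpan_of_edges hsum hp hvp (Fin.cons e fun _ => 1) ?_ ?_ ?_
    · intro j _
      refine Fin.cases heD (fun j => ?_) j
      simp only [Fin.cons_succ]; omega
    · intro j _
      refine Fin.cases ?_ (fun j => ?_) j
      · rw [Fin.cons_zero, add_comm (Pi.single _ _)]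
        exact hAe i
      · exact hA i j
    · intro j _ l
      refine Fin.cases (hdvdall l) (fun j => one_dvd _) j
  · rw [Set.singleton_subset_iff]
    by_contra hreg
    -- Were vertex 0 smooth, its edge steps would be 1: each divides column `j`, which contains the
    -- entry 1 as soon as there is a second index `j'`, and otherwise the gcd condition applies.
    -- Then `e ∣ D - 1` gives `e = 1`, contradicting `hlast`.
    have hone : ∀ j : Fin d, (Pi.single 0 (D - 1) + Pi.single j.succ 1 : Fin (d + 1) → ℕ) ∈
        Set.range b := by
      intro j
      obtain ⟨g, -, -, hg, hgdvd⟩ := exists_edge_of_not_isSingularPoint hb hD0 hsum hvert hb0 hreg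
        j.succ (Fin.succ_ne_zero j)
      have : g = 1 := by
        apply hgcd
        intro l j'
        by_cases hjj : j' = j
        · subst hjj
          exact hgdvd l
        · obtain ⟨p, hp⟩ := hA j' j
          have h1 := hgdvd p
          rw [hp] at h1
          have h2 : g ∣ 1 := by simpa [hjj, Ne.symm hjj] using h1
          exact h2.trans (one_dvd _)
      rwa [this] at hg
    by_cases hd0 : d = 0
    · subst hd0
      -- With no columns the gcd condition holds vacuously for `g = 0`, giving `0 = 1`.
      exact absurd (hgcd 0 fun _ j => j.elim0) (by omega)
    have he1 : e = 1 := by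
      obtain ⟨p, hp⟩ := hone ⟨0, Nat.pos_of_ne_zero hd0⟩
      have h1 := hdvdall p
      rw [hp] at h1
      have h2 : e ∣ D - 1 := by simpa using h1
      exact Nat.dvd_one.mp ((Nat.dvd_sub_iff_right (by omega) hdvd).mp h2)
    obtain ⟨j, hj⟩ := hlast he1
    exact hj (hone j)

end Main

end OneSing

end

theorem mainTheorem11 {k : Type*} [Field k] [IsAlgClosed k] (n d D : ℕ) (hd : 1 ≤ d) (hnd : d ≤ n)
    (hD : 2 ≤ D) (a : Fin (n + 1) → Fin d → ℕ) (ha : Function.Injective a)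
    (ha0 : a 0 = 0) (haD : ∀ j : Fin d, (Pi.single j D : Fin d → ℕ) ∈ Set.range a)
    (hsize : ∀ i, OneSing.size (a i) ≤ D) :
    ((∀ g : ℕ, (∀ i j, g ∣ a i j) → g = 1) →
      [OneSing.SingleSingularPoint k D a,
        ∃ e, OneSing.HomogenizedShape D a e,
        ∃ e, OneSing.AffineShape D a e,
        ∃ e, OneSing.SumsetStructure D a e].TFAE) ∧
    ∀ e, [OneSing.HomogenizedShape D a e, OneSing.AffineShape D a e, OneSing.SumsetStructure D a e].TFAE := by
  have hcd : ∀ e, OneSing.AffineShape D a e ↔ OneSing.SumsetStructure D a e := fun e =>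
    ⟨fun h => h.sumsetStructure (by omega) hsize, fun h => h.affineShape hd hD ha0 haD hsize⟩
  have hbc : ∀ e, OneSing.HomogenizedShape D a e ↔ OneSing.AffineShape D a e := fun e =>
    OneSing.homogenizedShape_iff_affineShape hD ha0 hsize
  refine ⟨fun hgcd => ?_, fun e => ?_⟩
  · tfae_have 1 ↔ 2 := ⟨fun h => h.exists_homogenizedShape hd hD ha ha0 haD hsize hgcd,
      fun ⟨_, h⟩ => h.singleSingularPoint hD ha ha0 haD hsize hgcd⟩
    tfae_have 2 ↔ 3 := exists_congr hbc
    tfae_have 3 ↔ 4 := exists_congr hcd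
    tfae_finish
  · tfae_have 1 ↔ 2 := hbc e
    tfae_have 2 ↔ 3 := hcd e
    tfae_finish
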